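/- (Rigidity of isometric flows on spheres) Let $\Sigma$ be a smooth manifold, $U\subseteq\Sigma$ a connected open subset and $k\ge 0$. A smooth singular foliation $\mathcal F$ of a manifold $M$ is a partition of $M$ into connected, injectively immersed submanifolds (leaves) such that every vector tangent to a leaf extends to a smooth vector field on $M$ that is everywhere tangent to the leaves; together with a smooth Riemannian metric $g$ it is a singular Riemannian foliation if every geodesic that is perpendicular at one point to a leaf is perpendicular to every leaf it meets, and a singular Riemannian flow if moreover the maximal dimension of the leaves is one. The flow is oriented if the tangent lines of its one-dimensional leaves are given orientations that depend continuously on the point. Let $(\mathbb C^k\times U,\mathcal F,g)$ be an oriented singular Riemannian flow. Suppose that there is a function $\alpha=(\alpha_1,\dots,\alpha_k):U\to S^{k-1}=\{a\in\mathbb R^k: a_1^2+\dots+a_k^2=1\}$ such that for every $s\in U$ the flow restricts on $\mathbb C^k\times\{s\}$ to the linear isometric flow $$(z_1,\dots,z_k)\mapsto\left(e^{i\alpha_1(s)t}z_1,\dots,e^{i\alpha_k(s)t}z_k\right),\qquad t\in\mathbb R,$$ that is, the leaf through $(z,s)$ is the orbit of $(z,s)$ under it, and the one-dimensional leaves are oriented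 by the direction of this motion. Then $\alpha$ is constant on $U$. -/

import Mathlib

-- These two instances see through `TopCat.of` and would otherwise wrap every charted space below.
attribute [-instance] TopCat.of.chartedSpace TopCat.of.hasGroupoid

open scoped Manifold ContDiff Topology
open Set

noncomputable section

/-! ### Singular foliations in the sense of Stefan and Sussmann -/

section Foliation

universe uE uH uM

variable {E : Type uE} [NormedAddCommGroup E] [NormedSpace ℝ E]
  {H : Type uH} [TopologicalSpace H] (I : ModelWithCorners ℝ E H)
  {M : Type uM} [TopologicalSpace M] [ChartedSpace H M] [IsManifold I ∞ M]

/-- `IsSmoothVectorField I V`: `V` is a smooth vector field on the whole manifold `M`. -/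
def IsSmoothVectorField (V : ∀ x : M, TangentSpace I x) : Prop :=
  ContMDiff I I.tangent ∞ (fun x => (⟨x, V x⟩ : TangentBundle I M))

/-- `IsImmersedLeaf I L T`: the set `L` is the image of a nonempty connected manifold `N`
(Hausdorff, second countable, without boundary, of some finite dimension `d`) under an injective
smooth immersion `f`, and `T (f y)` is the tangent space of this immersed submanifold at `f y`. -/
def IsImmersedLeaf (L : Set M) (T : ∀ x : M, Submodule ℝ (TangentSpace I x)) : Prop :=
  ∃ (d : ℕ) (N : Type uM) (_ : TopologicalSpace N)
    (_ : ChartedSpace (EuclideanSpace ℝ (Fin d)) N),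
    IsManifold (𝓡 d) ∞ N ∧ T2Space N ∧ SecondCountableTopology N ∧ ConnectedSpace N ∧
    ∃ f : N → M, ContMDiff (𝓡 d) I ∞ f ∧ Function.Injective f ∧
      (∀ y, Function.Injective (mfderiv (𝓡 d) I f y)) ∧
      Set.range f = L ∧
      ∀ y, LinearMap.range (mfderiv (𝓡 d) I f y).toLinearMap = T (f y)

variable (M) in
/-- A smooth singular foliation of `M`: a partition of `M` into connected, injectively immersed
submanifolds (the leaves), such that every vector tangent to a leaf extends to a smooth vector
field on `M` that is everywhere tangent to the leaves. -/
structure SingularFoliation where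
  /-- The equivalence relation of lying on the same leaf. -/
  leafRel : Setoid M
  /-- The tangent space at `x` of the leaf through `x`. -/
  tangent : ∀ x : M, Submodule ℝ (TangentSpace I x)
  isImmersedLeaf : ∀ x : M, IsImmersedLeaf I {y | leafRel x y} tangent
  exists_vectorField : ∀ (x : M), ∀ v ∈ tangent x,
    ∃ V : ∀ y : M, TangentSpace I y,
      IsSmoothVectorField I V ∧ V x = v ∧ ∀ y, V y ∈ tangent y

variable {I}

/-- The leaf through `x`. -/
def SingularFoliation.leaf (F : SingularFoliation I M) (x : M) : Set M :=
  {y | F.leafRel x y}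

/-- A singular flow: a singular foliation whose leaves have maximal dimension one. -/
def SingularFoliation.IsFlow (F : SingularFoliation I M) : Prop :=
  (∀ x, Module.finrank ℝ (F.tangent x) ≤ 1) ∧ ∃ x, Module.finrank ℝ (F.tangent x) = 1

/-- An orientation of a singular flow: at every point `x` of a one-dimensional leaf one of the two
open rays of the tangent line is declared positive, and this choice is continuous in the sense that
near such a point it is given by a smooth vector field tangent to the flow.
(The value of `pos` at a point of a zero-dimensional leaf is irrelevant.) -/
structure SingularFoliation.Orientation (F : SingularFoliation I M) where
  /-- The set of positively oriented tangent vectors. -/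
  pos : ∀ x : M, Set (TangentSpace I x)
  pos_eq_ray : ∀ x, F.tangent x ≠ ⊥ →
    ∃ v ∈ F.tangent x, v ≠ 0 ∧ pos x = {w | ∃ c : ℝ, 0 < c ∧ w = c • v}
  exists_vectorField : ∀ x, F.tangent x ≠ ⊥ →
    ∃ V : ∀ y : M, TangentSpace I y,
      IsSmoothVectorField I V ∧ (∀ y, V y ∈ F.tangent y) ∧ ∀ᶠ y in 𝓝 x, V y ∈ pos y

end Foliation

/-! ### Geodesics and singular Riemannian foliations -/

section Riemannian

variable {E : Type*} [NormedAddCommGroup E] [NormedSpace ℝ E]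
  {H : Type*} [TopologicalSpace H] {I : ModelWithCorners ℝ E H} [I.Boundaryless]
  {M : Type*} [TopologicalSpace M] [ChartedSpace H M] [IsManifold I ∞ M]

variable (I M) in
/-- A smooth Riemannian metric on the manifold `M`. -/
abbrev SmoothRiemannianMetric :=
  Bundle.ContMDiffRiemannianMetric I ∞ E (fun x : M => TangentSpace I x)

/-- The metric coefficient `p ↦ g_p(v, w)` in the preferred chart at `x₀`, for constant coordinate
vectors `v` and `w`. -/
def SmoothRiemannianMetric.inChart (g : SmoothRiemannianMetric I M) (x₀ : M) (v w : E) (p : E) :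
    ℝ :=
  g.inner ((extChartAt I x₀).symm p)
    (mfderiv 𝓘(ℝ, E) I (extChartAt I x₀).symm p v)
    (mfderiv 𝓘(ℝ, E) I (extChartAt I x₀).symm p w)

/-- The Christoffel symbol of the first kind in the preferred chart at `x₀`, that is
`g(∇_u v, w)` at the coordinate point `p`, for constant coordinate vectors `u`, `v`, `w`. -/
def SmoothRiemannianMetric.christoffel (g : SmoothRiemannianMetric I M) (x₀ : M) (u v w : E)
    (p : E) : ℝ :=
  (fderiv ℝ (g.inChart x₀ v w) p u + fderiv ℝ (g.inChart x₀ u w) p v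
    - fderiv ℝ (g.inChart x₀ u v) p w) / 2

/-- The velocity vector of the curve `γ` at time `t`. -/
def curveVelocity (I : ModelWithCorners ℝ E H) (γ : ℝ → M) (t : ℝ) : TangentSpace I (γ t) :=
  mfderiv 𝓘(ℝ, ℝ) I γ t (1 : ℝ)

/-- `γ` is a geodesic of `g` on the open set `J` of times: it is smooth and, in the
chart at `γ t`, its coordinate expression `c` satisfies at time `t` the geodesic equation
`c'' + Γ(c', c') = 0`, whose index is lowered here by pairing it with all coordinate vectors `w`. -/
def SmoothRiemannianMetric.IsGeodesicOn (g : SmoothRiemannianMetric I M) (γ : ℝ → M)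
    (J : Set ℝ) : Prop :=
  ContMDiffOn 𝓘(ℝ, ℝ) I ∞ γ J ∧
    ∀ t ∈ J, let c : ℝ → E := fun τ => extChartAt I (γ t) (γ τ)
      ∀ w : E, g.inChart (γ t) (deriv (deriv c) t) w (c t)
        + g.christoffel (γ t) (deriv c t) (deriv c t) w (c t) = 0

/-- The triple `(M, F, g)` is a singular Riemannian foliation: every geodesic that is
perpendicular at one point to a leaf is perpendicular to every leaf it meets. -/
def SingularFoliation.IsRiemannian (F : SingularFoliation I M) (g : SmoothRiemannianMetric I M) :
    Prop :=
  ∀ (γ : ℝ → M) (J : Set ℝ), IsOpen J → J.OrdConnected → g.IsGeodesicOn γ J →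
    ∀ t₀ ∈ J, (∀ w ∈ F.tangent (γ t₀), g.inner (γ t₀) (curveVelocity I γ t₀) w = 0) →
      ∀ t ∈ J, ∀ w ∈ F.tangent (γ t), g.inner (γ t) (curveVelocity I γ t) w = 0

end Riemannian

/-- The linear isometric flow of `ℂ^k` with weights `α`:
`(z_1, …, z_k) ↦ (exp(i α_1 t) z_1, …, exp(i α_k t) z_k)`. -/
def weightFlow {k : ℕ} (α : EuclideanSpace ℝ (Fin k)) (t : ℝ) (z : EuclideanSpace ℂ (Fin k)) :
    EuclideanSpace ℂ (Fin k) :=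
  WithLp.toLp 2 fun j => Complex.exp (Complex.I * (α j : ℂ) * (t : ℂ)) * z j

/-- The flow line of `weightFlow α` starting at `z`, inside the slice of `ℂ^k × U` over `s`. -/
def sliceFlowLine {k : ℕ} {U : Type*} (α : EuclideanSpace ℝ (Fin k))
    (z : EuclideanSpace ℂ (Fin k)) (s : U) (t : ℝ) : EuclideanSpace ℂ (Fin k) × U :=
  (weightFlow α t z, s)

/-- On every slice `ℂ^k × {s}` the oriented singular flow `(F, o)` is the linear isometric flow
with weights `α s`: the leaf through `(z, s)` is the orbit of that point and, unless the point is
fixed, the velocity of the orbit at time `0`, where it passes through `(z, s)`, is positively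
oriented.  (As `z` varies this covers the velocities of all orbits at all times.) -/
def RestrictsToWeightFlow {k n : ℕ} {U : Type*} [TopologicalSpace U]
    [ChartedSpace (EuclideanSpace ℝ (Fin n)) U] [IsManifold (𝓡 n) ∞ U]
    (F : SingularFoliation (𝓘(ℝ, EuclideanSpace ℂ (Fin k)).prod (𝓡 n))
      (EuclideanSpace ℂ (Fin k) × U))
    (o : F.Orientation) (α : U → EuclideanSpace ℝ (Fin k)) : Prop :=
  ∀ (z : EuclideanSpace ℂ (Fin k)) (s : U),
    F.leaf (z, s) = Set.range (sliceFlowLine (α s) z s) ∧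
    (curveVelocity (𝓘(ℝ, EuclideanSpace ℂ (Fin k)).prod (𝓡 n)) (sliceFlowLine (α s) z s) 0 ≠ 0 →
      curveVelocity (𝓘(ℝ, EuclideanSpace ℂ (Fin k)).prod (𝓡 n)) (sliceFlowLine (α s) z s) 0
        ∈ o.pos (sliceFlowLine (α s) z s 0))

end

/-! Let `X` be the field generating the given linear flow on each slice. At z = (1,…,1) it has norm
|α| = 1, so normalising a smooth positively oriented field near such a point recovers α: the weights
are smooth. Where `X` does not vanish it spans the leaves. A geodesic starting perpendicular to `X`
stays so; differentiating g(c', X) = 0 and using the geodesic equation gives (L_X g)(v, v) = 0 for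
all v ⟂ X (`SingularFoliation.IsRiemannian.lie_apply_eq_zero`).

The rigidity comes from expanding this at a fixed point (0, w₀) along the points (εζ, w₀)
(`exists_expansion_of_perp`). Let T be the linearisation v ↦ (iαv₁, 0), g the metric at the fixed
point, D its derivative and a' the derivative of the weights at w₀. Order zero makes T skew for g.
Order one says, for v ⟂ Tζ, that D(Tζ)(v, v) + 2 D(ζ)(v, Tv) = -2m with m = g(v, i a'(v₂) ζ). The
left side is the time derivative of D(ζ)(v, v) when ζ and v are moved by the flow, and m does not
change under this motion. A bounded function cannot have a constant nonzero derivative, so m = 0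
(`eq_zero_of_cohomological`).

With ζ = (1,…,1) and v varied, m = 0 forces a'(w) to be parallel to α (`weights_eq_zero_of_perp`).
But |α| = 1 makes a'(w) orthogonal to α, so a' = 0 and α is constant on the connected set U. The
remaining work supplies enough geodesics: they are solved for in one chart and transferred to the
manifold by invariance of the geodesic equation. -/

noncomputable section

/-! ### The linear isometric flow and its generator -/

/-- The generator `(α, z) ↦ (i α_1 z_1, …, i α_k z_k)` of `weightFlow` as a bilinear map. -/
def weightGenerator (k : ℕ) :
    EuclideanSpace ℝ (Fin k) →L[ℝ] EuclideanSpace ℂ (Fin k) →L[ℝ] EuclideanSpace ℂ (Fin k) :=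
  LinearMap.toContinuousBilinearMap (LinearMap.mk₂ ℝ
    (fun α z => WithLp.toLp 2 fun j => Complex.I * (α j : ℂ) * z j)
    (fun α β z => by ext j; simp; ring)
    (fun c α z => by ext j; simp; ring)
    (fun α z w => by ext j; simp; ring)
    (fun c α z => by ext j; simp; ring))

variable {k : ℕ}

@[simp]
theorem weightGenerator_apply (α : EuclideanSpace ℝ (Fin k)) (z : EuclideanSpace ℂ (Fin k))
    (j : Fin k) : weightGenerator k α z j = Complex.I * (α j : ℂ) * z j := rfl

@[simp]
theorem weightFlow_apply (α : EuclideanSpace ℝ (Fin k)) (t : ℝ) (z : EuclideanSpace ℂ (Fin k))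
    (j : Fin k) :
    weightFlow α t z j = Complex.exp (Complex.I * (α j : ℂ) * (t : ℂ)) * z j := rfl

@[simp]
theorem weightFlow_zero (α : EuclideanSpace ℝ (Fin k)) (z : EuclideanSpace ℂ (Fin k)) :
    weightFlow α 0 z = z := by
  ext j; simp

theorem norm_weightFlow (α : EuclideanSpace ℝ (Fin k)) (t : ℝ) (z : EuclideanSpace ℂ (Fin k)) :
    ‖weightFlow α t z‖ = ‖z‖ := by
  rw [EuclideanSpace.norm_eq, EuclideanSpace.norm_eq]
  congr 1
  refine Finset.sum_congr rfl fun j _ => ?_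
  have h : Complex.I * (α j : ℂ) * (t : ℂ) = ((α j * t : ℝ) : ℂ) * Complex.I := by
    push_cast; ring
  rw [weightFlow_apply, norm_mul, h, Complex.norm_exp_ofReal_mul_I, one_mul]

theorem weightFlow_weightGenerator (α β : EuclideanSpace ℝ (Fin k)) (t : ℝ)
    (z : EuclideanSpace ℂ (Fin k)) :
    weightFlow α t (weightGenerator k β z) = weightGenerator k β (weightFlow α t z) := by
  ext j; simp; ring

theorem hasDerivAt_weightFlow (α : EuclideanSpace ℝ (Fin k)) (z : EuclideanSpace ℂ (Fin k))
    (t : ℝ) :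
    HasDerivAt (fun τ => weightFlow α τ z) (weightGenerator k α (weightFlow α t z)) t := by
  suffices h : HasDerivAt (fun τ => (fun j => weightFlow α τ z j : Fin k → ℂ))
      (fun j => weightGenerator k α (weightFlow α t z) j) t from
    (PiLp.continuousLinearEquiv 2 ℝ fun _ : Fin k => ℂ).symm.hasFDerivAt.comp_hasDerivAt t h
  refine hasDerivAt_pi.2 fun j => ?_
  have h1 : HasDerivAt (fun τ : ℝ => (τ : ℂ)) 1 t := Complex.ofRealCLM.hasDerivAt
  have h := ((h1.const_mul (Complex.I * (α j : ℂ))).cexp).mul_const (z j)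
  convert! h using 1
  simp; ring

/-- The vector (1,…,1) sees every weight at once, so the generator with unit weights never vanishes
there. -/
theorem norm_weightGenerator_const_one (α : EuclideanSpace ℝ (Fin k)) :
    ‖weightGenerator k α (WithLp.toLp 2 fun _ => 1)‖ = ‖α‖ := by
  rw [EuclideanSpace.norm_eq, EuclideanSpace.norm_eq]
  simp

/-! ### Fields of scalar products on a normed space -/

section ScalarProductField

set_option maxSynthPendingDepth 3

variable {P : Type*} [NormedAddCommGroup P] [NormedSpace ℝ P]

/-- The difference quotient at 0 is R itself, so continuity suffices. In the expansion below R
contains the derivative of a metric that is only assumed C¹. -/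
theorem hasDerivAt_mul_of_continuousAt {R : ℝ → ℝ} (hR : ContinuousAt R 0) :
    HasDerivAt (fun ε => ε * R ε) (R 0) 0 := by
  rw [hasDerivAt_iff_tendsto_slope]
  refine (hR.tendsto.mono_left nhdsWithin_le_nhds).congr' ?_
  filter_upwards [self_mem_nhdsWithin] with ε hε
  have : ε ≠ 0 := hε
  simp [slope_def_field]
  field_simp

theorem HasFDerivAt.apply_symm {G : P → P →L[ℝ] P →L[ℝ] ℝ} {D : P →L[ℝ] P →L[ℝ] P →L[ℝ] ℝ}
    {p : P} (hG : HasFDerivAt G D p) (hsymm : ∀ᶠ q in 𝓝 p, ∀ u v, G q u v = G q v u)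
    (x u v : P) : D x u v = D x v u := by
  have h1 : ∀ u v, HasFDerivAt (fun q => G q u v) ((D.flip u).flip v) p := by
    intro u v
    have := (hG.clm_apply (hasFDerivAt_const u _)).clm_apply (hasFDerivAt_const v _)
    convert! this using 1
    ext; simp
  have h2 := (h1 u v).congr_of_eventuallyEq
    (f₁ := fun q => G q v u) (by filter_upwards [hsymm] with q hq using hq v u)
  have h3 := congrArg (fun f => f x) ((h1 v u).unique h2)
  simpa using h3.symm

/-- A solution of a cohomological equation over a bounded flow has vanishing constant term. -/
theorem eq_zero_of_cohomological {D : P →L[ℝ] P →L[ℝ] P →L[ℝ] ℝ} {T : P → P}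
    (hDsymm : ∀ x u v, D x u v = D x v u) {x x' y : ℝ → P} {m a b : ℝ}
    (hx : ∀ t, HasDerivAt x (x' t) t) (hy : ∀ t, HasDerivAt y (T (y t)) t)
    (hxn : ∀ t, ‖x t‖ = a) (hyn : ∀ t, ‖y t‖ = b)
    (h : ∀ t, D (x' t) (y t) (y t) + 2 * D (x t) (y t) (T (y t)) + 2 * m = 0) : m = 0 := by
  -- By symmetry of D the hypothesis is exactly the product rule for D(x)(y, y), up to the drift 2m.
  have hd : ∀ t, HasDerivAt (fun τ => D (x τ) (y τ) (y τ) + 2 * m * τ) 0 t := by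
    intro t
    have h1 := (((D.hasFDerivAt.comp_hasDerivAt t (hx t)).clm_apply (hy t)).clm_apply (hy t)).add
      ((hasDerivAt_id t).const_mul (2 * m))
    convert! h1 using 1
    have h2 := hDsymm (x t) (T (y t)) (y t)
    have h3 := h t
    simp only [add_apply, mul_one, Function.comp_apply]
    linarith
  have hconst : ∀ t, D (x t) (y t) (y t) + 2 * m * t = D (x 0) (y 0) (y 0) := by
    intro t
    have h := is_const_of_deriv_eq_zero (fun t => (hd t).differentiableAt)
      (fun t => (hd t).deriv) t 0
    simpa using h
  have hbound : ∀ t, |D (x t) (y t) (y t)| ≤ ‖D‖ * a * b * b := by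
    intro t
    rw [← Real.norm_eq_abs, ← hxn t, ← hyn t]
    calc ‖D (x t) (y t) (y t)‖ ≤ ‖D (x t)‖ * ‖y t‖ * ‖y t‖ := (D (x t)).le_opNorm₂ _ _
      _ ≤ (‖D‖ * ‖x t‖) * ‖y t‖ * ‖y t‖ := by gcongr; exact D.le_opNorm _
  by_contra hm0
  set C := ‖D‖ * a * b * b
  have hC := hbound 0
  -- At this time the drift is 2C + 2, more than the 2C by which a quantity bounded by C can vary.
  have h1 := hconst ((C + 1) / m)
  have h2 := abs_le.1 (hbound ((C + 1) / m))
  have h3 := abs_le.1 hC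
  have h4 : 2 * m * ((C + 1) / m) = 2 * (C + 1) := by field_simp
  rw [h4] at h1
  linarith [h2.1, h2.2, h3.1, h3.2]

/-- First order expansion at `ε = 0` of a condition imposed on the vectors perpendicular to `A` at
the points `p₀ + ε ζ`. -/
theorem exists_expansion_of_perp {G : P → P →L[ℝ] P →L[ℝ] ℝ} {p₀ ζ A v : P} {T B : P →L[ℝ] P}
    (hG : ContDiffAt ℝ 1 G p₀) (hA : 0 < G p₀ A A) (hv : G p₀ v A = 0)
    (h : ∀ ε : ℝ, ε ≠ 0 → ∀ u, G (p₀ + ε • ζ) u A = 0 →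
      ε * fderiv ℝ G (p₀ + ε • ζ) A u u + 2 * G (p₀ + ε • ζ) u (T u + ε • B u) = 0) :
    ∃ n' : P, ∃ c : ℝ, c ≠ 0 ∧ G p₀ (c • v) (T (c • v)) = 0 ∧
      fderiv ℝ G p₀ ζ (c • v) (T (c • v)) + G p₀ n' (T (c • v)) + G p₀ (c • v) (T n')
        = -(1 / 2 * fderiv ℝ G p₀ A (c • v) (c • v) + G p₀ (c • v) (B (c • v))) := by
  let p : ℝ → P := fun ε => p₀ + ε • ζ
  have hp0 : p 0 = p₀ := by simp [p]
  have hpd : HasDerivAt p ζ 0 := by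
    have := ((hasDerivAt_id (0 : ℝ)).smul_const ζ).const_add p₀
    rwa [one_smul] at this
  have hGp : HasDerivAt (fun ε => G (p ε)) (fderiv ℝ G p₀ ζ) 0 := by
    have h1 : HasFDerivAt G (fderiv ℝ G p₀) (p 0) := by
      rw [hp0]; exact (hG.differentiableAt one_ne_zero).hasFDerivAt
    exact h1.comp_hasDerivAt 0 hpd
  have hDp : ContinuousAt (fun ε => fderiv ℝ G (p ε)) 0 := by
    have h1 : ContinuousAt (fderiv ℝ G) (p 0) := by
      rw [hp0]; exact (hG.fderiv_right (m := 0) (by norm_num)).continuousAt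
    exact ContinuousAt.comp (f := p) h1 hpd.continuousAt
  -- The part of v perpendicular to A at p(ε), multiplied by G(A, A) to avoid a division; hence u(0)
  -- = c v with c = G(A, A) at p₀. The vector n' of the conclusion is u'(0).
  let u : ℝ → P := fun ε => G (p ε) A A • v - G (p ε) v A • A
  have hud : DifferentiableAt ℝ u 0 := by
    have h1 := hGp.differentiableAt
    exact (((h1.clm_apply (differentiableAt_const A)).clm_apply
      (differentiableAt_const A)).smul_const v).sub (((h1.clm_apply
      (differentiableAt_const v)).clm_apply (differentiableAt_const A)).smul_const A)
  have hu0 : u 0 = G p₀ A A • v := by simp [u, hp0, hv]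
  have huc := hud.continuousAt
  have hGc := hGp.continuousAt
  let R : ℝ → ℝ := fun ε => -(1 / 2 * fderiv ℝ G (p ε) A (u ε) (u ε) + G (p ε) (u ε) (B (u ε)))
  have hRc : ContinuousAt R 0 :=
    ((continuousAt_const.mul (((hDp.clm_apply continuousAt_const).clm_apply huc).clm_apply
      huc)).add ((hGc.clm_apply huc).clm_apply (B.continuous.continuousAt.comp huc))).neg
  let N : ℝ → ℝ := fun ε => G (p ε) (u ε) (T (u ε))
  have hNd : HasDerivAt N (fderiv ℝ G p₀ ζ (u 0) (T (u 0)) + G (p 0) (deriv u 0) (T (u 0))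
      + G (p 0) (u 0) (T (deriv u 0))) 0 := by
    have h1 := (hGp.clm_apply hud.hasDerivAt).clm_apply
      (T.hasFDerivAt.comp_hasDerivAt 0 hud.hasDerivAt)
    convert! h1 using 1
  have hNR : ∀ ε, ε ≠ 0 → N ε = ε * R ε := by
    intro ε hε
    have h1 := h ε hε (u ε) (by
      simp only [u, p, map_sub, map_smul, sub_apply, smul_apply, smul_eq_mul]
      ring)
    rw [map_add, map_smul, smul_eq_mul] at h1
    simp only [N, R, p] at h1 ⊢
    linarith
  -- The hypothesis is silent at ε = 0, where the generating field vanishes; continuity fills the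
  -- gap.
  have hN0 : N 0 = 0 := by
    have t1 : Filter.Tendsto N (𝓝[≠] 0) (𝓝 (N 0)) :=
      hNd.continuousAt.tendsto.mono_left nhdsWithin_le_nhds
    have t2 : Filter.Tendsto (fun ε => ε * R ε) (𝓝[≠] 0) (𝓝 (0 * R 0)) :=
      (continuousAt_id.mul hRc).tendsto.mono_left nhdsWithin_le_nhds
    have t3 := t2.congr' (by
      filter_upwards [self_mem_nhdsWithin] with ε hε using (hNR ε hε).symm)
    rw [zero_mul] at t3
    exact tendsto_nhds_unique t1 t3
  have hNeq : N = fun ε => ε * R ε := by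
    funext ε
    by_cases hε : ε = 0
    · rw [hε, hN0, zero_mul]
    · exact hNR ε hε
  have hder := hNd.unique (hNeq ▸ hasDerivAt_mul_of_continuousAt hRc)
  refine ⟨deriv u 0, G p₀ A A, hA.ne', ?_, ?_⟩
  · rw [← hu0]
    simpa [N, hp0] using hN0
  · rw [← hu0]
    simpa only [R, hp0] using hder

end ScalarProductField

/-! ### Rigidity of the weights at a fixed point of the flow -/

section Rigidity

set_option maxSynthPendingDepth 3

variable {W : Type*} [NormedAddCommGroup W] [NormedSpace ℝ W]
  {α : EuclideanSpace ℝ (Fin k)}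

/-- If the generator `A` satisfies `g(v, A v) = 0` for all `v` perpendicular to some nonzero vector
in the image of `A`, then `g(v, A v) = 0` for all `v`. -/
theorem apply_weightGenerator_self_eq_zero
    {g : (EuclideanSpace ℂ (Fin k) × W) →L[ℝ] (EuclideanSpace ℂ (Fin k) × W) →L[ℝ] ℝ}
    (h : ∀ ζ, weightGenerator k α ζ ≠ 0 → ∀ v, g v (weightGenerator k α ζ, 0) = 0 →
      g v (weightGenerator k α v.1, 0) = 0) (v : EuclideanSpace ℂ (Fin k) × W) :
    g v (weightGenerator k α v.1, 0) = 0 := by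
  by_contra hv
  have hne : weightGenerator k α v.1 ≠ 0 := by
    intro h0; apply hv; rw [h0]; exact map_zero _
  set b := g v (weightGenerator k α v.1, 0)
  set c := g v (weightGenerator k α (Complex.I • v.1), 0)
  have hlin : ∀ x y : EuclideanSpace ℂ (Fin k), ∀ r s : ℝ,
      g v (r • x - s • y, 0) = r * g v (x, 0) - s * g v (y, 0) := by
    intro x y r s
    have : ((r • x - s • y, 0) : EuclideanSpace ℂ (Fin k) × W) = r • (x, 0) - s • (y, 0) := by
      ext <;> simp
    rw [this, map_sub, map_smul, map_smul]; rfl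
  -- The generator is complex linear, so it sends this ζ to (c - bi) times its value at v.1, which
  -- is nonzero since b ≠ 0. The pairing with v is cb - bc = 0.
  refine hv (h (c • v.1 - b • (Complex.I • v.1)) ?_ v ?_)
  · rw [map_sub, map_smul, map_smul]
    intro h0
    obtain ⟨j, hj⟩ : ∃ j, weightGenerator k α v.1 j ≠ 0 := by
      by_contra! hall
      exact hne (by ext j; simpa using hall j)
    have h1 := congrArg (fun z : EuclideanSpace ℂ (Fin k) => z j) h0
    simp only [PiLp.sub_apply, PiLp.smul_apply, weightGenerator_apply, PiLp.zero_apply,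
      smul_eq_mul, Complex.real_smul] at h1 hj
    have h2 : ((c : ℂ) - b * Complex.I) * (Complex.I * (α j : ℂ) * v.1 j) = 0 := by
      rw [← h1]; ring
    have h3 := (mul_eq_zero.1 h2).resolve_right hj
    have h4 := congrArg Complex.im h3
    simp at h4
    exact hv h4
  · rw [map_sub, map_smul, map_smul, hlin]
    ring

variable {g : (EuclideanSpace ℂ (Fin k) × W) →L[ℝ] (EuclideanSpace ℂ (Fin k) × W) →L[ℝ] ℝ}
  {D : (EuclideanSpace ℂ (Fin k) × W) →L[ℝ]
    (EuclideanSpace ℂ (Fin k) × W) →L[ℝ] (EuclideanSpace ℂ (Fin k) × W) →L[ℝ] ℝ}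
  {a' : W →L[ℝ] EuclideanSpace ℝ (Fin k)}

theorem hasDerivAt_weightFlow_prod (α : EuclideanSpace ℝ (Fin k))
    (v : EuclideanSpace ℂ (Fin k) × W) (t : ℝ) :
    HasDerivAt (fun τ => (weightFlow α τ v.1, v.2))
      ((weightGenerator k α (weightFlow α t v.1), 0) : EuclideanSpace ℂ (Fin k) × W) t :=
  (hasDerivAt_weightFlow α v.1 t).prodMk (hasDerivAt_const t v.2)

/-- Skewness of the generator integrates: the pairing has zero derivative along the flow. -/
theorem apply_weightFlow_weightFlow
    (hskew : ∀ u v : EuclideanSpace ℂ (Fin k) × W,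
      g (weightGenerator k α u.1, 0) v + g u (weightGenerator k α v.1, 0) = 0)
    (u v : EuclideanSpace ℂ (Fin k) × W) (t : ℝ) :
    g (weightFlow α t u.1, u.2) (weightFlow α t v.1, v.2) = g u v := by
  have hd : ∀ t, HasDerivAt
      (fun τ => g (weightFlow α τ u.1, u.2) (weightFlow α τ v.1, v.2)) 0 t := by
    intro t
    have h := (g.hasFDerivAt.comp_hasDerivAt t (hasDerivAt_weightFlow_prod α u t)).clm_apply
      (hasDerivAt_weightFlow_prod α v t)
    convert! h using 1
    exact (hskew (weightFlow α t u.1, u.2) (weightFlow α t v.1, v.2)).symm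
  have h := is_const_of_deriv_eq_zero (fun t => (hd t).differentiableAt)
    (fun t => (hd t).deriv) t 0
  simpa using h

/-- The averaging step: the zeroth order term of a cohomological equation over the bounded flow
`weightFlow` vanishes. -/
theorem apply_weightGenerator_eq_zero_of_cohomological
    (hskew : ∀ u v : EuclideanSpace ℂ (Fin k) × W,
      g (weightGenerator k α u.1, 0) v + g u (weightGenerator k α v.1, 0) = 0)
    (hDsymm : ∀ x u v, D x u v = D x v u)
    (hD : ∀ ζ, weightGenerator k α ζ ≠ 0 → ∀ v, g v (weightGenerator k α ζ, 0) = 0 →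
      D (weightGenerator k α ζ, 0) v v + 2 * D (ζ, 0) v (weightGenerator k α v.1, 0)
        + 2 * g v (weightGenerator k (a' v.2) ζ, 0) = 0)
    {ζ : EuclideanSpace ℂ (Fin k)} (hζ : weightGenerator k α ζ ≠ 0)
    {v : EuclideanSpace ℂ (Fin k) × W} (hv : g v (weightGenerator k α ζ, 0) = 0) :
    g v (weightGenerator k (a' v.2) ζ, 0) = 0 := by
  -- The flow is isometric and commutes with every generator. With β = α this keeps the moved
  -- vectors perpendicular; with β = a'(v.2) it makes the inhomogeneous term constant in time.
  have hyg : ∀ t β, g (weightFlow α t v.1, v.2) (weightGenerator k β (weightFlow α t ζ), 0)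
      = g v (weightGenerator k β ζ, 0) := by
    intro t β
    have h := apply_weightFlow_weightFlow hskew v (weightGenerator k β ζ, 0) t
    rwa [weightFlow_weightGenerator] at h
  refine eq_zero_of_cohomological (D := D) (T := fun v => (weightGenerator k α v.1, 0))
    (x := fun t => (weightFlow α t ζ, 0)) (y := fun t => (weightFlow α t v.1, v.2))
    (a := ‖ζ‖) (b := ‖v‖) hDsymm
    (hasDerivAt_weightFlow_prod α ((ζ, 0) : EuclideanSpace ℂ (Fin k) × W))
    (hasDerivAt_weightFlow_prod α v) ?_ ?_ ?_
  · intro t; simp [Prod.norm_def, norm_weightFlow]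
  · intro t; simp [Prod.norm_def, norm_weightFlow]
  · intro t
    have hne : weightGenerator k α (weightFlow α t ζ) ≠ 0 := by
      rw [← weightFlow_weightGenerator, ← norm_ne_zero_iff, norm_weightFlow]
      exact norm_ne_zero_iff.2 hζ
    have h1 := hD _ hne (weightFlow α t v.1, v.2) ((hyg t α).trans hv)
    rwa [hyg t] at h1

/-- Only the W-component of v enters the weights a'(v.2), so adding to v a vector u tangent to the
slice keeps B fixed. Subtracting the two resulting conditions gives g(u, B) = 0. For u the multiple
of the part of B perpendicular to A this yields g(u, u) = 0, so B is parallel to A and a'(w) to α.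
-/
theorem weights_eq_zero_of_perp (hpos : ∀ v, v ≠ 0 → 0 < g v v) (hα : α ≠ 0)
    (hnorm : ∀ w, inner ℝ α (a' w) = 0)
    (h : ∀ ζ, weightGenerator k α ζ ≠ 0 → ∀ v, g v (weightGenerator k α ζ, 0) = 0 →
      g v (weightGenerator k (a' v.2) ζ, 0) = 0) : a' = 0 := by
  ext1 w
  set e : EuclideanSpace ℂ (Fin k) := WithLp.toLp 2 fun _ => 1 with he
  set A : EuclideanSpace ℂ (Fin k) × W := (weightGenerator k α e, 0) with hA
  set B : EuclideanSpace ℂ (Fin k) × W := (weightGenerator k (a' w) e, 0) with hB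
  have hAe : weightGenerator k α e ≠ 0 := by
    rw [← norm_ne_zero_iff, norm_weightGenerator_const_one]
    exact norm_ne_zero_iff.2 hα
  have hA0 : A ≠ 0 := fun h0 => hAe (congrArg Prod.fst h0)
  have hAA := hpos A hA0
  set a := g A A with ha
  set b := g B A with hb
  set v : EuclideanSpace ℂ (Fin k) × W := (0, w) - (g (0, w) A / a) • A with hv
  set u : EuclideanSpace ℂ (Fin k) × W := a • B - b • A with hu
  have hvA : g v A = 0 := by
    simp only [hv, map_sub, map_smul, sub_apply,
      smul_apply, smul_eq_mul, ← ha]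
    field_simp; ring
  have huA : g u A = 0 := by
    simp only [hu, map_sub, map_smul, sub_apply,
      smul_apply, smul_eq_mul, ← ha, ← hb]
    ring
  have hv2 : v.2 = w := by simp [hv, hA]
  have huv2 : (u + v).2 = w := by simp [hu, hv, hA, hB]
  have h1 := h e hAe v hvA
  have h2 := h e hAe (u + v) (by rw [map_add, add_apply]; simp [← hA, hvA, huA])
  rw [hv2, ← hB] at h1
  rw [huv2, ← hB, map_add, add_apply, h1, add_zero] at h2
  have huu : g u u = 0 := by
    conv_lhs => rw [hu]
    simp only [hu, map_sub, map_smul, sub_apply,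
      smul_apply, smul_eq_mul] at huA h2 ⊢
    linear_combination a * h2 - b * huA
  have hu0 : u = 0 := by
    by_contra h0
    exact (hpos u h0).ne' huu
  -- Imaginary parts at (1,…,1) read off the weights.
  have hk : a • a' w = b • α := by
    ext j
    have := congrArg (fun x : EuclideanSpace ℂ (Fin k) × W => (x.1 j).im) hu0
    simp [hu, hA, hB, he] at this
    simp; linarith
  have h3 : b * inner ℝ α α = 0 := by
    rw [← inner_smul_right, ← hk, inner_smul_right, hnorm, mul_zero]
  have hb0 : b = 0 := (mul_eq_zero.1 h3).resolve_right (by simpa using hα)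
  rw [hb0, zero_smul] at hk
  exact (smul_eq_zero.1 hk).resolve_left hAA.ne'

/-- Let `G` be a field of scalar products for which the vector field `z ↦ i α z` is
infinitesimally isometric in the transverse directions along the slice over `w₀`. Then the
derivative `a'` of the weights at `w₀` vanishes. -/
theorem weights_deriv_eq_zero {w₀ : W}
    {G : EuclideanSpace ℂ (Fin k) × W →
      (EuclideanSpace ℂ (Fin k) × W) →L[ℝ] (EuclideanSpace ℂ (Fin k) × W) →L[ℝ] ℝ}
    (hG : ContDiffAt ℝ 1 G (0, w₀))
    (hsymm : ∀ᶠ p in 𝓝 (0, w₀), ∀ u v, G p u v = G p v u)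
    (hpos : ∀ v, v ≠ 0 → 0 < G (0, w₀) v v) (hα : α ≠ 0)
    (hnorm : ∀ w, inner ℝ α (a' w) = 0)
    (h : ∀ z, weightGenerator k α z ≠ 0 → ∀ v, G (z, w₀) v (weightGenerator k α z, 0) = 0 →
      fderiv ℝ G (z, w₀) (weightGenerator k α z, 0) v v
        + 2 * G (z, w₀) v (weightGenerator k α v.1 + weightGenerator k (a' v.2) z, 0) = 0) :
    a' = 0 := by
  set g := G (0, w₀) with hg
  have hgsymm : ∀ u v, g u v = g v u := hsymm.self_of_nhds
  have hDsymm := (hG.differentiableAt one_ne_zero).hasFDerivAt.apply_symm hsymm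
  let T : (EuclideanSpace ℂ (Fin k) × W) →L[ℝ] (EuclideanSpace ℂ (Fin k) × W) :=
    (ContinuousLinearMap.inl ℝ _ _).comp
      ((weightGenerator k α).comp (ContinuousLinearMap.fst ℝ _ _))
  have hT : ∀ v, T v = (weightGenerator k α v.1, 0) := fun v => rfl
  let B : EuclideanSpace ℂ (Fin k) →
      (EuclideanSpace ℂ (Fin k) × W) →L[ℝ] (EuclideanSpace ℂ (Fin k) × W) := fun ζ =>
    (ContinuousLinearMap.inl ℝ _ _).comp
      (((weightGenerator k).flip ζ).comp (a'.comp (ContinuousLinearMap.snd ℝ _ _)))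
  have hB : ∀ ζ v, B ζ v = (weightGenerator k (a' v.2) ζ, 0) := fun ζ v => rfl
  -- The field at εζ is ε times the field at ζ, so the perpendicularity condition does not depend on
  -- the scale and the factor ε can be pulled out.
  have key : ∀ ζ, weightGenerator k α ζ ≠ 0 → ∀ v, g v (weightGenerator k α ζ, 0) = 0 →
      ∃ n' : EuclideanSpace ℂ (Fin k) × W, ∃ c : ℝ, c ≠ 0 ∧ g (c • v) (T (c • v)) = 0 ∧
        fderiv ℝ G (0, w₀) (ζ, 0) (c • v) (T (c • v)) + g n' (T (c • v)) + g (c • v) (T n')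
          = -(1 / 2 * fderiv ℝ G (0, w₀) (weightGenerator k α ζ, 0) (c • v) (c • v)
            + g (c • v) (B ζ (c • v))) := by
    intro ζ hζ v hv
    have hA0 : ((weightGenerator k α ζ, 0) : EuclideanSpace ℂ (Fin k) × W) ≠ 0 :=
      fun h0 => hζ (congrArg Prod.fst h0)
    refine exists_expansion_of_perp hG (hpos _ hA0) hv fun ε hε u hu => ?_
    have e0 : ((0, w₀) : EuclideanSpace ℂ (Fin k) × W) + ε • (ζ, 0) = (ε • ζ, w₀) := by simp
    have e1 : weightGenerator k α (ε • ζ) = ε • weightGenerator k α ζ := map_smul _ _ _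
    have e2 : ((weightGenerator k α (ε • ζ), 0) : EuclideanSpace ℂ (Fin k) × W)
        = ε • (weightGenerator k α ζ, 0) := by
      rw [e1]; simp
    have e3 : ((weightGenerator k α u.1 + weightGenerator k (a' u.2) (ε • ζ), 0) :
        EuclideanSpace ℂ (Fin k) × W) = T u + ε • B ζ u := by
      rw [hT, hB, map_smul]; simp
    rw [e0] at hu ⊢
    have h1 := h (ε • ζ) (by rw [e1]; exact smul_ne_zero hε hζ) u (by
      rw [e2, map_smul, hu, smul_zero])
    rw [e2, e3, map_smul, smul_apply, smul_apply, smul_eq_mul] at h1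
    exact h1
  have hself : ∀ v, g v (weightGenerator k α v.1, 0) = 0 := by
    refine apply_weightGenerator_self_eq_zero fun ζ hζ v hv => ?_
    obtain ⟨-, c, hc, h1, -⟩ := key ζ hζ v hv
    rw [map_smul, map_smul, smul_apply, map_smul, smul_smul] at h1
    exact (smul_eq_zero.1 h1).resolve_left (mul_ne_zero hc hc)
  have hskew : ∀ u v : EuclideanSpace ℂ (Fin k) × W,
      g (weightGenerator k α u.1, 0) v + g u (weightGenerator k α v.1, 0) = 0 := by
    intro u v
    have h1 : g (u + v) (T (u + v)) = 0 := hself (u + v)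
    have h2 : g u (T u) = 0 := hself u
    have h3 : g v (T v) = 0 := hself v
    simp only [map_add, add_apply] at h1
    change g (T u) v + g u (T v) = 0
    rw [hgsymm (T u) v]
    linarith
  refine weights_eq_zero_of_perp (g := g) hpos hα hnorm fun ζ hζ v hv => ?_
  refine apply_weightGenerator_eq_zero_of_cohomological hskew hDsymm ?_ hζ hv
  intro ζ hζ v hv
  obtain ⟨n', c, hc, -, h1⟩ := key ζ hζ v hv
  -- Skewness cancels the two terms in n', the unknown first variation of the perpendicular vector.
  have h2 : g (T n') (c • v) + g n' (T (c • v)) = 0 := hskew n' (c • v)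
  rw [hgsymm (T n')] at h2
  -- What remains is quadratic in v, so the scaling c factors out.
  have h3 : c * c * (fderiv ℝ G (0, w₀) (weightGenerator k α ζ, 0) v v
      + 2 * fderiv ℝ G (0, w₀) (ζ, 0) v (T v) + 2 * g v (B ζ v)) = 0 := by
    simp only [map_smul, smul_apply, smul_eq_mul] at h1 h2
    linarith
  exact (mul_eq_zero.1 h3).resolve_left (mul_ne_zero hc hc)

end Rigidity

/-! ### Geodesics in coordinates -/

section CoordinateGeodesics

set_option maxSynthPendingDepth 3

variable {P : Type*} [NormedAddCommGroup P] [NormedSpace ℝ P]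
  {Q : Type*} [NormedAddCommGroup Q] [NormedSpace ℝ Q]

/-- The Christoffel symbol of the first kind `Γ(u, u)` of the metric `G` as a covector. -/
def christoffelCovector (G : P → P →L[ℝ] P →L[ℝ] ℝ) (p u : P) : P →L[ℝ] ℝ :=
  fderiv ℝ G p u u - (1 / 2 : ℝ) • ((fderiv ℝ G p).flip u).flip u

@[simp]
theorem christoffelCovector_apply (G : P → P →L[ℝ] P →L[ℝ] ℝ) (p u w : P) :
    christoffelCovector G p u w = fderiv ℝ G p u u w - 1 / 2 * fderiv ℝ G p w u u := by
  simp [christoffelCovector]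

/-- The curve `c` satisfies the geodesic equation of the metric `G` at the time `t`. -/
def SatisfiesGeodesicEquation (G : P → P →L[ℝ] P →L[ℝ] ℝ) (c : ℝ → P) (t : ℝ) : Prop :=
  ∀ w, G (c t) (deriv (deriv c) t) w + christoffelCovector G (c t) (deriv c t) w = 0

/-- Solutions of an autonomous smooth differential equation are smooth. -/
theorem ContDiffOn.of_autonomous_ode {Φ : P → P} {Ω : Set P} (hΦ : ContDiffOn ℝ ∞ Φ Ω)
    {J : Set ℝ} (hJ : IsOpen J) {y : ℝ → P} (hy : ∀ t ∈ J, HasDerivAt y (Φ (y t)) t)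
    (hΩ : ∀ t ∈ J, y t ∈ Ω) : ContDiffOn ℝ ∞ y J := by
  rw [contDiffOn_infty]
  intro n
  induction n with
  | zero =>
    exact contDiffOn_zero.2 fun t ht => (hy t ht).continuousAt.continuousWithinAt
  | succ n ih =>
    refine (contDiffOn_succ_iff_deriv_of_isOpen (n := n) hJ).2
      ⟨fun t ht => (hy t ht).differentiableAt.differentiableWithinAt, by simp, ?_⟩
    refine ((hΦ.of_le (mod_cast le_top)).comp ih hΩ).congr fun t ht => (hy t ht).deriv

theorem ContinuousLinearMap.isInvertible_of_pos [FiniteDimensional ℝ P] {g : P →L[ℝ] P →L[ℝ] ℝ}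
    (hg : ∀ v, v ≠ 0 → 0 < g v v) : g.IsInvertible := by
  have hinj : Function.Injective g.toLinearMap := by
    rw [← LinearMap.ker_eq_bot, LinearMap.ker_eq_bot']
    intro v hv
    by_contra h0
    have h1 : g v = 0 := hv
    have := hg v h0
    rw [h1] at this
    simp at this
  have hdim : Module.finrank ℝ P = Module.finrank ℝ (P →L[ℝ] ℝ) := by
    rw [← (LinearMap.toContinuousLinearMap (𝕜 := ℝ) (E := P) (F' := ℝ)).finrank_eq]
    exact (Subspace.dual_finrank_eq).symm
  refine ⟨(LinearEquiv.ofInjectiveOfFinrankEq g.toLinearMap hinj hdim).toContinuousLinearEquiv, ?_⟩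
  ext; rfl

/-- Definiteness makes G invertible, so the equation can be solved for the acceleration; it becomes
a smooth first order system for (c, c') on Ω × P, and Picard–Lindelöf applies. -/
theorem exists_geodesic [FiniteDimensional ℝ P] {G : P → P →L[ℝ] P →L[ℝ] ℝ} {Ω : Set P}
    (hΩ : IsOpen Ω) (hG : ContDiffOn ℝ ∞ G Ω) (hpos : ∀ p ∈ Ω, ∀ v, v ≠ 0 → 0 < G p v v)
    {p v : P} (hp : p ∈ Ω) :
    ∃ ε > 0, ∃ c : ℝ → P, c 0 = p ∧ deriv c 0 = v ∧ ContDiffOn ℝ ∞ c (Ioo (-ε) ε) ∧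
      ∀ t ∈ Ioo (-ε) ε, c t ∈ Ω ∧ SatisfiesGeodesicEquation G c t := by
  have : CompleteSpace P := FiniteDimensional.complete ℝ P
  let K : P × P → P →L[ℝ] ℝ := fun x => christoffelCovector G x.1 x.2
  let Φ : P × P → P × P := fun x => (x.2, -(G x.1).inverse (K x))
  let Ω' : Set (P × P) := Ω ×ˢ univ
  have hΩ' : IsOpen Ω' := hΩ.prod isOpen_univ
  have hfst : ContDiffOn ℝ ∞ (Prod.fst : P × P → P) Ω' := contDiff_fst.contDiffOn
  have hsnd : ContDiffOn ℝ ∞ (Prod.snd : P × P → P) Ω' := contDiff_snd.contDiffOn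
  have hmaps : MapsTo (Prod.fst : P × P → P) Ω' Ω := fun x hx => hx.1
  have hD : ContDiffOn ℝ ∞ (fun x : P × P => fderiv ℝ G x.1) Ω' :=
    (hG.fderiv_of_isOpen hΩ le_rfl).comp hfst hmaps
  have hK : ContDiffOn ℝ ∞ K Ω' := by
    refine ((hD.clm_apply hsnd).clm_apply hsnd).sub (ContDiffOn.const_smul (1 / 2 : ℝ) ?_)
    have h1 := (ContinuousLinearMap.flipₗᵢ ℝ P P (P →L[ℝ] ℝ)).contDiff.comp_contDiffOn hD
    exact ((ContinuousLinearMap.flipₗᵢ ℝ P P ℝ).contDiff.comp_contDiffOn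
      (h1.clm_apply hsnd)).clm_apply hsnd
  have hinv : ContDiffOn ℝ ∞ (fun x : P × P => (G x.1).inverse) Ω' := by
    intro x hx
    have h1 := (ContinuousLinearMap.isInvertible_of_pos (hpos x.1 hx.1)).contDiffAt_map_inverse
      (n := ∞)
    exact h1.comp_contDiffWithinAt x ((hG.comp hfst hmaps) x hx)
  have hΦ : ContDiffOn ℝ ∞ Φ Ω' := hsnd.prodMk (hinv.clm_apply hK).neg
  have hpv : (p, v) ∈ Ω' := ⟨hp, mem_univ _⟩
  have hΦ1 : ContDiffAt ℝ 1 Φ (p, v) :=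
    ((hΦ.contDiffAt (hΩ'.mem_nhds hpv)).of_le (mod_cast le_top))
  obtain ⟨y, hy0, δ, hδ, hy⟩ :=
    hΦ1.exists_forall_mem_closedBall_exists_eq_forall_mem_Ioo_hasDerivAt₀ 0
  simp only [zero_sub, zero_add] at hy
  have hcont : ContinuousAt y 0 := (hy 0 ⟨by linarith, hδ⟩).continuousAt
  have hev : ∀ᶠ t in 𝓝 (0 : ℝ), y t ∈ Ω' := hcont (by rw [hy0]; exact hΩ'.mem_nhds hpv)
  obtain ⟨η, hη, hball⟩ := Metric.eventually_nhds_iff_ball.1 hev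
  set ε := min δ η with hε
  have hεpos : 0 < ε := lt_min hδ hη
  have hmemΩ : ∀ t ∈ Ioo (-ε) ε, y t ∈ Ω' := by
    intro t ht
    refine hball t ?_
    rw [Metric.mem_ball, Real.dist_eq, sub_zero, abs_lt]
    exact ⟨by linarith [ht.1, min_le_right δ η], by linarith [ht.2, min_le_right δ η]⟩
  have hder : ∀ t ∈ Ioo (-ε) ε, HasDerivAt y (Φ (y t)) t := fun t ht =>
    hy t ⟨by linarith [ht.1, min_le_left δ η], by linarith [ht.2, min_le_left δ η]⟩
  have hsm := hΦ.of_autonomous_ode isOpen_Ioo hder hmemΩ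
  have h1 : ∀ t ∈ Ioo (-ε) ε, HasDerivAt (fun τ => (y τ).1) (y t).2 t := fun t ht =>
    (hasFDerivAt_fst (𝕜 := ℝ) (p := y t)).comp_hasDerivAt t (hder t ht)
  have h2 : ∀ t ∈ Ioo (-ε) ε,
      HasDerivAt (fun τ => (y τ).2) (-(G (y t).1).inverse (K (y t))) t := fun t ht =>
    (hasFDerivAt_snd (𝕜 := ℝ) (p := y t)).comp_hasDerivAt t (hder t ht)
  have h0 : (0 : ℝ) ∈ Ioo (-ε) ε := ⟨by linarith, hεpos⟩
  refine ⟨ε, hεpos, fun t => (y t).1, by simp [hy0], by simp [(h1 0 h0).deriv, hy0],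
    contDiff_fst.comp_contDiffOn hsm, fun t ht => ⟨(hmemΩ t ht).1, fun w => ?_⟩⟩
  have hd2 : deriv (deriv fun τ => (y τ).1) t = -(G (y t).1).inverse (K (y t)) := by
    have he : (deriv fun τ => (y τ).1) =ᶠ[𝓝 t] fun τ => (y τ).2 := by
      filter_upwards [isOpen_Ioo.mem_nhds ht] with τ hτ using (h1 τ hτ).deriv
    rw [he.deriv_eq, (h2 t ht).deriv]
  rw [hd2, (h1 t ht).deriv, map_neg]
  obtain ⟨e, he⟩ := ContinuousLinearMap.isInvertible_of_pos (hpos (y t).1 (hmemΩ t ht).1)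
  have h3 : G (y t).1 ((G (y t).1).inverse (K (y t))) = K (y t) := by
    rw [← he, ContinuousLinearMap.inverse_equiv]
    simp
  rw [h3]
  simp [K]

/-- The geodesic equation is invariant under changes of coordinates. -/
theorem SatisfiesGeodesicEquation.comp {G : P → P →L[ℝ] P →L[ℝ] ℝ} {G' : Q → Q →L[ℝ] Q →L[ℝ] ℝ}
    {h : P → Q} {c : ℝ → P} {t : ℝ} (hgeo : SatisfiesGeodesicEquation G c t)
    (hc : ContDiffAt ℝ 2 c t) (hh : ContDiffAt ℝ 2 h (c t)) (hG' : DifferentiableAt ℝ G' (h (c t)))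
    (hsymm : ∀ u v, G' (h (c t)) u v = G' (h (c t)) v u)
    (hiso : ∀ᶠ q in 𝓝 (c t), ∀ v w, G q v w = G' (h q) (fderiv ℝ h q v) (fderiv ℝ h q w))
    (hGd : DifferentiableAt ℝ G (c t))
    (hsurj : Function.Surjective (fderiv ℝ h (c t))) :
    SatisfiesGeodesicEquation G' (fun τ => h (c τ)) t := by
  set p := c t with hp
  set v := deriv c t with hv
  have hcd : HasDerivAt c v t := (hc.differentiableAt two_ne_zero).hasDerivAt
  have hcd2 : HasDerivAt (deriv c) (deriv (deriv c) t) t := by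
    have h1 : ContDiffAt ℝ 1 (deriv c) t := by
      have := (hc.fderiv_right (m := 1) (by norm_num)).clm_apply
        (contDiffAt_const (c := (1 : ℝ)))
      simpa using this
    exact (h1.differentiableAt one_ne_zero).hasDerivAt
  have hhd : ∀ᶠ q in 𝓝 p, HasFDerivAt h (fderiv ℝ h q) q := by
    filter_upwards [hh.eventually (by simp)] with q hq
    exact (hq.differentiableAt two_ne_zero).hasFDerivAt
  have hhp := hhd.self_of_nhds
  have hh2 : HasFDerivAt (fderiv ℝ h) (fderiv ℝ (fderiv ℝ h) p) p :=
    ((hh.fderiv_right (m := 1) (by norm_num)).differentiableAt one_ne_zero).hasFDerivAt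
  have hsym2 : ∀ u w, fderiv ℝ (fderiv ℝ h) p u w = fderiv ℝ (fderiv ℝ h) p w u := by
    have : IsSymmSndFDerivAt ℝ h p := hh.isSymmSndFDerivAt (by simp)
    exact fun u w => this u w
  -- derivatives of the curve in the new coordinates
  have hc' : ∀ᶠ τ in 𝓝 t, deriv (fun τ => h (c τ)) τ = fderiv ℝ h (c τ) (deriv c τ) := by
    have hcdev : ∀ᶠ τ in 𝓝 t, HasDerivAt c (deriv c τ) τ := by
      filter_upwards [hc.eventually (by simp)] with τ hτ
      exact (hτ.differentiableAt two_ne_zero).hasDerivAt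
    filter_upwards [hcdev, hcd.continuousAt.eventually hhd] with τ h1 h2
    exact (h2.comp_hasDerivAt τ h1).deriv
  have hc'' : deriv (deriv fun τ => h (c τ)) t
      = fderiv ℝ (fderiv ℝ h) p v v + fderiv ℝ h p (deriv (deriv c) t) := by
    rw [Filter.EventuallyEq.deriv_eq hc']
    exact ((hh2.comp_hasDerivAt t hcd).clm_apply hcd2).deriv
  -- derivative of the metric
  have hDG : ∀ x u w, fderiv ℝ G p x u w
      = fderiv ℝ G' (h p) (fderiv ℝ h p x) (fderiv ℝ h p u) (fderiv ℝ h p w)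
        + G' (h p) (fderiv ℝ (fderiv ℝ h) p x u) (fderiv ℝ h p w)
        + G' (h p) (fderiv ℝ h p u) (fderiv ℝ (fderiv ℝ h) p x w) := by
    intro x u w
    have h1 : HasFDerivAt (fun q => G q u w) (((fderiv ℝ G p).flip u).flip w) p := by
      have := (hGd.hasFDerivAt.clm_apply (hasFDerivAt_const u p)).clm_apply
        (hasFDerivAt_const w p)
      convert! this using 1
      ext; simp
    have h2 := ((hG'.hasFDerivAt.comp p hhp).clm_apply
      (hh2.clm_apply (hasFDerivAt_const u p))).clm_apply (hh2.clm_apply (hasFDerivAt_const w p))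
    have h3 := h2.congr_of_eventuallyEq (f₁ := fun q => G q u w)
      (by filter_upwards [hiso] with q hq using hq u w)
    have h4 := congrArg (fun f => f x) (h1.unique h3)
    simp at h4
    linarith
  intro w'
  -- Surjectivity lets every test vector be pulled back. In the pulled-back symbol the second
  -- derivatives of h cancel, by symmetry of h'' and G', except for G'(h''(v, v), h' w), which is
  -- the extra term in the second derivative of h ∘ c.
  obtain ⟨w, rfl⟩ := hsurj w'
  have h1 := hgeo w
  rw [← hp, hiso.self_of_nhds, christoffelCovector_apply, hDG, hDG, hsym2 w v,
    hsymm (fderiv ℝ (fderiv ℝ h) p v w)] at h1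
  rw [hc'', hc'.self_of_nhds, christoffelCovector_apply, ← hp, ← hv, map_add, add_apply]
  linarith

/-- If a geodesic stays perpendicular to the vector field `Y`, then `Y` is infinitesimally
isometric in its direction. -/
theorem SatisfiesGeodesicEquation.lie_apply_eq_zero {G : P → P →L[ℝ] P →L[ℝ] ℝ} {c : ℝ → P}
    {t : ℝ} (hgeo : SatisfiesGeodesicEquation G c t) (hc : ContDiffAt ℝ 2 c t)
    (hG : DifferentiableAt ℝ G (c t)) {Y : P → P} {Y' : P →L[ℝ] P} (hY : HasFDerivAt Y Y' (c t))
    (hperp : ∀ᶠ τ in 𝓝 t, G (c τ) (deriv c τ) (Y (c τ)) = 0) :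
    fderiv ℝ G (c t) (Y (c t)) (deriv c t) (deriv c t)
      + 2 * G (c t) (deriv c t) (Y' (deriv c t)) = 0 := by
  have hcd : HasDerivAt c (deriv c t) t := (hc.differentiableAt two_ne_zero).hasDerivAt
  have hcd2 : HasDerivAt (deriv c) (deriv (deriv c) t) t := by
    have h1 : ContDiffAt ℝ 1 (deriv c) t := by
      have := (hc.fderiv_right (m := 1) (by norm_num)).clm_apply
        (contDiffAt_const (c := (1 : ℝ)))
      simpa using this
    exact (h1.differentiableAt one_ne_zero).hasDerivAt
  have h1 := ((hG.hasFDerivAt.comp_hasDerivAt t hcd).clm_apply hcd2).clm_apply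
    (hY.comp_hasDerivAt t hcd)
  have h2 := h1.unique ((hasDerivAt_const t (0 : ℝ)).congr_of_eventuallyEq hperp)
  -- Testing with Y itself eliminates the acceleration from the differentiated perpendicularity
  -- relation.
  have h3 := hgeo (Y (c t))
  simp at h2 h3
  linarith

end CoordinateGeodesics

/-! ### Riemannian metrics in charts -/

section MetricInCharts

set_option maxSynthPendingDepth 3

variable {E : Type*} [NormedAddCommGroup E] [NormedSpace ℝ E]
  {H : Type*} [TopologicalSpace H] {I : ModelWithCorners ℝ E H}
  {M : Type*} [TopologicalSpace M] [ChartedSpace H M] [IsManifold I ∞ M]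

/-- The metric in the preferred chart at `x₀`, as a field of bilinear forms. -/
def SmoothRiemannianMetric.coordinateMetric (g : SmoothRiemannianMetric I M) (x₀ : M) (p : E) :
    E →L[ℝ] E →L[ℝ] ℝ :=
  let A : E →L[ℝ] E := mfderiv 𝓘(ℝ, E) I (extChartAt I x₀).symm p
  let B : E →L[ℝ] E →L[ℝ] ℝ := g.inner ((extChartAt I x₀).symm p)
  B.bilinearComp A A

theorem SmoothRiemannianMetric.coordinateMetric_apply (g : SmoothRiemannianMetric I M) (x₀ : M)
    (p v w : E) : g.coordinateMetric x₀ p v w = g.inChart x₀ v w p := rfl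

theorem SmoothRiemannianMetric.coordinateMetric_symm (g : SmoothRiemannianMetric I M) (x₀ : M)
    (p v w : E) : g.coordinateMetric x₀ p v w = g.coordinateMetric x₀ p w v := by
  rw [coordinateMetric_apply, coordinateMetric_apply]
  exact g.symm ((extChartAt I x₀).symm p) _ _

theorem mdifferentiableAt_extChartAt_symm [I.Boundaryless] {x₀ : M} {p : E}
    (hp : p ∈ (extChartAt I x₀).target) :
    MDifferentiableAt 𝓘(ℝ, E) I (extChartAt I x₀).symm p :=
  (((contMDiffOn_extChartAt_symm (I := I) (n := ∞) x₀) p hp).contMDiffAt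
    ((isOpen_extChartAt_target x₀).mem_nhds hp)).mdifferentiableAt (by simp)

theorem mdifferentiableAt_extChartAt' {x₀ x : M} (hx : x ∈ (extChartAt I x₀).source) :
    MDifferentiableAt I 𝓘(ℝ, E) (extChartAt I x₀) x :=
  mdifferentiableAt_extChartAt (by simpa using hx)

theorem mfderiv_extChartAt_symm_comp [I.Boundaryless] {x₀ : M} {p : E}
    (hp : p ∈ (extChartAt I x₀).target) (v : E) :
    mfderiv I 𝓘(ℝ, E) (extChartAt I x₀) ((extChartAt I x₀).symm p)
      (mfderiv 𝓘(ℝ, E) I (extChartAt I x₀).symm p v) = v := by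
  have h1 := mfderiv_comp_apply p (mdifferentiableAt_extChartAt' ((extChartAt I x₀).map_target hp))
    (mdifferentiableAt_extChartAt_symm hp) v
  have h2 : (extChartAt I x₀ ∘ (extChartAt I x₀).symm) =ᶠ[𝓝 p] id := by
    filter_upwards [(isOpen_extChartAt_target x₀).mem_nhds hp] with q hq
    exact (extChartAt I x₀).right_inv hq
  rw [h2.mfderiv_eq, mfderiv_id] at h1
  exact h1.symm

theorem SmoothRiemannianMetric.coordinateMetric_pos [I.Boundaryless]
    (g : SmoothRiemannianMetric I M) (x₀ : M) {p : E} (hp : p ∈ (extChartAt I x₀).target)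
    {v : E} (hv : v ≠ 0) :
    0 < g.coordinateMetric x₀ p v v := by
  rw [coordinateMetric_apply]
  refine g.pos ((extChartAt I x₀).symm p) _ fun h0 => hv ?_
  exact (mfderiv_extChartAt_symm_comp hp v).symm.trans
    ((congrArg (mfderiv I 𝓘(ℝ, E) (extChartAt I x₀) ((extChartAt I x₀).symm p)) h0).trans
      (map_zero _))

theorem SmoothRiemannianMetric.contDiffOn_coordinateMetric [I.Boundaryless] [FiniteDimensional ℝ E]
    (g : SmoothRiemannianMetric I M) (x₀ : M) :
    ContDiffOn ℝ ∞ (g.coordinateMetric x₀) (extChartAt I x₀).target := by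
  refine contDiffOn_clm_apply.2 fun v => contDiffOn_clm_apply.2 fun w => ?_
  have hφ := contMDiffOn_extChartAt_symm (I := I) (n := ∞) x₀
  have hopen := isOpen_extChartAt_target (I := I) x₀
  -- The coordinate field v is the image under the tangent map of the inverse chart of a constant
  -- section, hence smooth along it.
  have hT : ∀ v : E, ContMDiffOn 𝓘(ℝ, E) I.tangent ∞
      (fun p => (⟨(extChartAt I x₀).symm p,
        mfderiv 𝓘(ℝ, E) I (extChartAt I x₀).symm p v⟩ : TangentBundle I M))
      (extChartAt I x₀).target := by
    intro v
    have h1 := hφ.contMDiffOn_tangentMapWithin (m := ∞) le_rfl hopen.uniqueMDiffOn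
    have h2 : ContMDiff 𝓘(ℝ, E) 𝓘(ℝ, E).tangent ∞
        (fun p => (⟨p, v⟩ : TangentBundle 𝓘(ℝ, E) E)) := by
      exact fun p => contMDiffAt_vectorSpace_iff_contDiffAt.2 contDiffAt_const
    refine (h1.comp h2.contMDiffOn (fun p hp => hp)).congr fun p hp => ?_
    simp only [Function.comp_apply, tangentMapWithin]
    rw [mfderivWithin_of_isOpen hopen hp]
  have hg : ContMDiffOn 𝓘(ℝ, E) (I.prod 𝓘(ℝ, E →L[ℝ] E →L[ℝ] ℝ)) ∞
      (fun p => Bundle.TotalSpace.mk' (E →L[ℝ] E →L[ℝ] ℝ)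
        (E := fun x : M => TangentSpace I x →L[ℝ] TangentSpace I x →L[ℝ] ℝ)
        ((extChartAt I x₀).symm p) (g.inner ((extChartAt I x₀).symm p)))
      (extChartAt I x₀).target := g.contMDiff.comp_contMDiffOn hφ
  intro p hp
  have h3 : ContMDiffWithinAt 𝓘(ℝ, E) (I.prod 𝓘(ℝ, ℝ)) ∞
      (fun p => Bundle.TotalSpace.mk' ℝ (E := Bundle.Trivial M ℝ) ((extChartAt I x₀).symm p)
        (g.inner ((extChartAt I x₀).symm p) (mfderiv 𝓘(ℝ, E) I (extChartAt I x₀).symm p v)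
          (mfderiv 𝓘(ℝ, E) I (extChartAt I x₀).symm p w)))
      (extChartAt I x₀).target p := by
    apply ContMDiffWithinAt.clm_bundle_apply₂ (F₁ := E) (F₂ := E)
    · exact hg p hp
    · exact hT v p hp
    · exact hT w p hp
  simp only [Bundle.contMDiffWithinAt_totalSpace] at h3
  exact h3.2.contDiffWithinAt

end MetricInCharts

/-! ### Geodesics in charts -/

section GeodesicsInCharts

set_option maxSynthPendingDepth 3

variable {E : Type*} [NormedAddCommGroup E] [NormedSpace ℝ E]
  {H : Type*} [TopologicalSpace H] {I : ModelWithCorners ℝ E H} [I.Boundaryless]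
  {M : Type*} [TopologicalSpace M] [ChartedSpace H M] [IsManifold I ∞ M]

theorem contDiffAt_extChartAt_transition {x₀ x₁ : M} {p : E} (hp : p ∈ (extChartAt I x₀).target)
    (hp' : (extChartAt I x₀).symm p ∈ (extChartAt I x₁).source) :
    ContDiffAt ℝ ∞ (fun q => extChartAt I x₁ ((extChartAt I x₀).symm q)) p := by
  have h1 : ContMDiffAt 𝓘(ℝ, E) I ∞ (extChartAt I x₀).symm p :=
    ((contMDiffOn_extChartAt_symm (I := I) (n := ∞) x₀) p hp).contMDiffAt
      ((isOpen_extChartAt_target x₀).mem_nhds hp)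
  have h2 : ContMDiffAt I 𝓘(ℝ, E) ∞ (extChartAt I x₁) ((extChartAt I x₀).symm p) :=
    contMDiffAt_extChartAt' (by simpa using hp')
  exact (h2.comp p h1).contDiffAt

theorem eventually_mem_extChartAt_source {x₀ x₁ : M} {p : E} (hp : p ∈ (extChartAt I x₀).target)
    (hp' : (extChartAt I x₀).symm p ∈ (extChartAt I x₁).source) :
    ∀ᶠ q in 𝓝 p, q ∈ (extChartAt I x₀).target ∧
      (extChartAt I x₀).symm q ∈ (extChartAt I x₁).source := by
  refine Filter.Eventually.and ((isOpen_extChartAt_target x₀).mem_nhds hp) ?_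
  exact (mdifferentiableAt_extChartAt_symm hp).continuousAt.eventually
    ((isOpen_extChartAt_source x₁).mem_nhds hp')

theorem mfderiv_extChartAt_symm_transition {x₀ x₁ : M} {p : E}
    (hp : p ∈ (extChartAt I x₀).target)
    (hp' : (extChartAt I x₀).symm p ∈ (extChartAt I x₁).source) (v : E) :
    (mfderiv 𝓘(ℝ, E) I (extChartAt I x₀).symm p v : E)
      = mfderiv 𝓘(ℝ, E) I (extChartAt I x₁).symm (extChartAt I x₁ ((extChartAt I x₀).symm p))
        (fderiv ℝ (fun q => extChartAt I x₁ ((extChartAt I x₀).symm q)) p v) := by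
  have h1 := ((contDiffAt_extChartAt_transition hp hp').differentiableAt
    (by simp)).mdifferentiableAt
  have h2 := mdifferentiableAt_extChartAt_symm (I := I) ((extChartAt I x₁).map_source hp')
  have h3 : (extChartAt I x₁).symm ∘ (fun q => extChartAt I x₁ ((extChartAt I x₀).symm q))
      =ᶠ[𝓝 p] (extChartAt I x₀).symm := by
    filter_upwards [eventually_mem_extChartAt_source hp hp'] with q hq
    exact (extChartAt I x₁).left_inv hq.2
  have h4 := mfderiv_comp_apply p h2 h1 v
  rw [mfderiv_eq_fderiv] at h4
  refine Eq.trans ?_ h4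
  exact congrArg (fun f : E →L[ℝ] E => f v) h3.mfderiv_eq.symm

theorem fderiv_extChartAt_transition_surjective [FiniteDimensional ℝ E] {x₀ x₁ : M} {p : E}
    (hp : p ∈ (extChartAt I x₀).target)
    (hp' : (extChartAt I x₀).symm p ∈ (extChartAt I x₁).source) :
    Function.Surjective
      (fderiv ℝ (fun q => extChartAt I x₁ ((extChartAt I x₀).symm q)) p) := by
  set f := fderiv ℝ (fun q => extChartAt I x₁ ((extChartAt I x₀).symm q)) p with hf
  have hinj : Function.Injective f.toLinearMap := by
    rw [← LinearMap.ker_eq_bot, LinearMap.ker_eq_bot']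
    intro v hv
    have h1 := mfderiv_extChartAt_symm_transition hp hp' v
    have h2 : f v = 0 := hv
    rw [← hf, h2] at h1
    have h3 := h1.trans (map_zero _)
    exact (mfderiv_extChartAt_symm_comp hp v).symm.trans
      ((congrArg (mfderiv I 𝓘(ℝ, E) (extChartAt I x₀) ((extChartAt I x₀).symm p)) h3).trans
        (map_zero _))
  exact LinearMap.injective_iff_surjective.1 hinj

theorem SmoothRiemannianMetric.coordinateMetric_transition (g : SmoothRiemannianMetric I M)
    {x₀ x₁ : M} {p : E} (hp : p ∈ (extChartAt I x₀).target)
    (hp' : (extChartAt I x₀).symm p ∈ (extChartAt I x₁).source) (v w : E) :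
    g.coordinateMetric x₀ p v w
      = g.coordinateMetric x₁ (extChartAt I x₁ ((extChartAt I x₀).symm p))
        (fderiv ℝ (fun q => extChartAt I x₁ ((extChartAt I x₀).symm q)) p v)
        (fderiv ℝ (fun q => extChartAt I x₁ ((extChartAt I x₀).symm q)) p w) := by
  -- The two base points are equal only propositionally, so the pairing has to be transported.
  have hinner : ∀ (x y : M) (_ : x = y) (a b a' b' : E), a = a' → b = b' →
      g.inner x a b = g.inner y a' b' := by
    rintro x _ rfl a b _ _ rfl rfl
    rfl
  rw [g.coordinateMetric_apply, g.coordinateMetric_apply]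
  exact hinner _ _ ((extChartAt I x₁).left_inv hp').symm _ _ _ _
    (mfderiv_extChartAt_symm_transition hp hp' v) (mfderiv_extChartAt_symm_transition hp hp' w)

theorem SmoothRiemannianMetric.differentiableAt_coordinateMetric [FiniteDimensional ℝ E]
    (g : SmoothRiemannianMetric I M) {x₀ : M} {p : E} (hp : p ∈ (extChartAt I x₀).target) :
    DifferentiableAt ℝ (g.coordinateMetric x₀) p :=
  ((g.contDiffOn_coordinateMetric x₀).contDiffAt
    ((isOpen_extChartAt_target x₀).mem_nhds hp)).differentiableAt (by simp)

/-- On the diagonal the first two terms of the symbol coincide. -/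
theorem SmoothRiemannianMetric.christoffel_self [FiniteDimensional ℝ E]
    (g : SmoothRiemannianMetric I M) {x₀ : M} {p : E} (hp : p ∈ (extChartAt I x₀).target)
    (u w : E) :
    g.christoffel x₀ u u w p = christoffelCovector (g.coordinateMetric x₀) p u w := by
  have h1 : ∀ x u w, fderiv ℝ (g.inChart x₀ u w) p x
      = fderiv ℝ (g.coordinateMetric x₀) p x u w := by
    intro x u w
    have h2 := ((g.differentiableAt_coordinateMetric hp).hasFDerivAt.clm_apply
      (hasFDerivAt_const u p)).clm_apply (hasFDerivAt_const w p)
    have h3 : HasFDerivAt (g.inChart x₀ u w) _ p := h2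
    rw [h3.fderiv]
    simp
  rw [SmoothRiemannianMetric.christoffel, h1, h1, christoffelCovector_apply]
  ring

/-- A solution of the geodesic equation in one chart is a geodesic of the manifold. -/
theorem SmoothRiemannianMetric.isGeodesicOn_of_satisfiesGeodesicEquation [FiniteDimensional ℝ E]
    (g : SmoothRiemannianMetric I M) {x₀ : M} {c : ℝ → E} {J : Set ℝ} (hJ : IsOpen J)
    (hc : ContDiffOn ℝ ∞ c J) (htarget : ∀ t ∈ J, c t ∈ (extChartAt I x₀).target)
    (hgeo : ∀ t ∈ J, SatisfiesGeodesicEquation (g.coordinateMetric x₀) c t) :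
    g.IsGeodesicOn (fun t => (extChartAt I x₀).symm (c t)) J := by
  refine ⟨(contMDiffOn_extChartAt_symm x₀).comp hc.contMDiffOn htarget, fun t ht => ?_⟩
  intro _ w
  have hp := htarget t ht
  have hp' : (extChartAt I x₀).symm (c t)
      ∈ (extChartAt I ((extChartAt I x₀).symm (c t))).source := mem_extChartAt_source _
  have hq := (extChartAt I ((extChartAt I x₀).symm (c t))).map_source hp'
  -- `IsGeodesicOn` tests the equation in the chart at the current point, which changes with t;
  -- hence the change of coordinates from the fixed chart at x₀.
  have h1 := (hgeo t ht).comp (G' := g.coordinateMetric ((extChartAt I x₀).symm (c t)))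
    (h := fun q => extChartAt I ((extChartAt I x₀).symm (c t)) ((extChartAt I x₀).symm q))
    ((hc.contDiffAt (hJ.mem_nhds ht)).of_le (by norm_cast))
    ((contDiffAt_extChartAt_transition hp hp').of_le (by norm_cast))
    (g.differentiableAt_coordinateMetric hq) (g.coordinateMetric_symm _ _)
    (by
      filter_upwards [eventually_mem_extChartAt_source hp hp'] with q hq v w
      exact g.coordinateMetric_transition hq.1 hq.2 v w)
    (g.differentiableAt_coordinateMetric hp) (fderiv_extChartAt_transition_surjective hp hp')
  rw [g.christoffel_self hq, ← g.coordinateMetric_apply]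
  exact h1 w

theorem curveVelocity_extChartAt_symm {x₀ : M} {c : ℝ → E} {t : ℝ} (hc : DifferentiableAt ℝ c t)
    (ht : c t ∈ (extChartAt I x₀).target) :
    (curveVelocity I (fun τ => (extChartAt I x₀).symm (c τ)) t : E)
      = mfderiv 𝓘(ℝ, E) I (extChartAt I x₀).symm (c t) (deriv c t) := by
  have h := mfderiv_comp_apply t (mdifferentiableAt_extChartAt_symm ht) hc.mdifferentiableAt (1 : ℝ)
  rw [mfderiv_eq_fderiv] at h
  exact h

/-- Let `Y` represent in the chart at `x₀` a vector field `X` that spans the leaves of a singular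
Riemannian foliation wherever it does not vanish. Then the Lie derivative of the metric along `Y`
vanishes on all vectors perpendicular to `Y`. -/
theorem SingularFoliation.IsRiemannian.lie_apply_eq_zero [FiniteDimensional ℝ E]
    {F : SingularFoliation I M} {g : SmoothRiemannianMetric I M} (hF : F.IsRiemannian g)
    {X : ∀ x : M, TangentSpace I x} (hX : ∀ x, X x ∈ F.tangent x)
    (hspan : ∀ x, X x ≠ 0 → F.tangent x ≤ Submodule.span ℝ {X x}) {x₀ : M} {Y : E → E}
    (hXY : ∀ p ∈ (extChartAt I x₀).target,
      (mfderiv 𝓘(ℝ, E) I (extChartAt I x₀).symm p (Y p) : E) = X ((extChartAt I x₀).symm p))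
    {p v : E} (hp : p ∈ (extChartAt I x₀).target) {Y' : E →L[ℝ] E} (hY : HasFDerivAt Y Y' p)
    (hYp : Y p ≠ 0) (hv : g.coordinateMetric x₀ p v (Y p) = 0) :
    fderiv ℝ (g.coordinateMetric x₀) p (Y p) v v + 2 * g.coordinateMetric x₀ p v (Y' v) = 0 := by
  obtain ⟨ε, hε, c, hc0, hc0', hc, hcg⟩ := exists_geodesic (isOpen_extChartAt_target x₀)
    (g.contDiffOn_coordinateMetric x₀) (fun p hp v hv => g.coordinateMetric_pos x₀ hp hv) (v := v)
    hp
  have h0 : (0 : ℝ) ∈ Ioo (-ε) ε := ⟨by linarith, hε⟩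
  set γ : ℝ → M := fun t => (extChartAt I x₀).symm (c t) with hγ
  have hgeo := g.isGeodesicOn_of_satisfiesGeodesicEquation isOpen_Ioo hc
    (fun t ht => (hcg t ht).1) (fun t ht => (hcg t ht).2)
  have hcA : ∀ t ∈ Ioo (-ε) ε, ContDiffAt ℝ ∞ c t := fun t ht =>
    hc.contDiffAt (isOpen_Ioo.mem_nhds ht)
  have hXin : ∀ t ∈ Ioo (-ε) ε, g.inner (γ t) (curveVelocity I γ t) (X (γ t))
      = g.coordinateMetric x₀ (c t) (deriv c t) (Y (c t)) := by
    intro t ht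
    have h1 := curveVelocity_extChartAt_symm ((hcA t ht).differentiableAt (by simp)) (hcg t ht).1
    have h2 := hXY (c t) (hcg t ht).1
    rw [g.coordinateMetric_apply]
    have hinner : ∀ a b a' b' : E, a = a' → b = b' → g.inner (γ t) a b = g.inner (γ t) a' b' := by
      rintro a b _ _ rfl rfl
      rfl
    exact hinner _ _ _ _ h1 h2.symm
  have hX0 : X (γ 0) ≠ 0 := by
    intro h1
    have h2 := (hXY (c 0) (hcg 0 h0).1).trans h1
    have h3 := (mfderiv_extChartAt_symm_comp (hcg 0 h0).1 (Y (c 0))).symm.trans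
      ((congrArg (mfderiv I 𝓘(ℝ, E) (extChartAt I x₀) ((extChartAt I x₀).symm (c 0))) h2).trans
        (map_zero _))
    rw [hc0] at h3
    exact hYp h3
  -- At time 0 the field spans the tangent space of the leaf, so being perpendicular to it is
  -- enough; at later times only its tangency is used.
  have hperp := hF γ (Ioo (-ε) ε) isOpen_Ioo ordConnected_Ioo hgeo 0 h0 (by
    intro w hw
    obtain ⟨a, rfl⟩ := Submodule.mem_span_singleton.1 (hspan _ hX0 hw)
    rw [map_smul, hXin 0 h0, hc0, hc0', hv, smul_zero])
  have h1 := (hcg 0 h0).2.lie_apply_eq_zero ((hcA 0 h0).of_le (by norm_cast))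
    (g.differentiableAt_coordinateMetric (hcg 0 h0).1) (Y := Y) (Y' := Y') (by rwa [hc0]) (by
      filter_upwards [isOpen_Ioo.mem_nhds h0] with t ht
      rw [← hXin t ht]
      exact hperp t ht _ (hX _))
  rwa [hc0, hc0'] at h1

end GeodesicsInCharts

/-! ### Leaves of a singular flow -/

section Leaves

variable {E : Type*} [NormedAddCommGroup E] [NormedSpace ℝ E]
  {H : Type*} [TopologicalSpace H] {I : ModelWithCorners ℝ E H}
  {M : Type*} [TopologicalSpace M] [ChartedSpace H M] [IsManifold I ∞ M]

theorem ChartedSpace.subsingleton_of_connected_of_subsingleton {K N : Type*} [TopologicalSpace K]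
    [Subsingleton K] [TopologicalSpace N] [ChartedSpace K N] [PreconnectedSpace N] :
    Subsingleton N := by
  have hdisc : DiscreteTopology N := by
    refine discreteTopology_iff_isOpen_singleton.2 fun y => ?_
    have h : (chartAt K y).source = {y} := by
      refine subset_antisymm (fun x hx => ?_) (by simp)
      exact (chartAt K y).injOn hx (mem_chart_source K y) (Subsingleton.elim _ _)
    rw [← h]
    exact (chartAt K y).open_source
  exact PreconnectedSpace.trivial_of_discrete

/-- A leaf with vanishing tangent space is a point. -/
theorem SingularFoliation.subsingleton_leaf (F : SingularFoliation I M) {x : M}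
    (h : F.tangent x = ⊥) : (F.leaf x).Subsingleton := by
  obtain ⟨d, N, _, _, -, -, -, _, f, -, -, hinj, hrange, htan⟩ := F.isImmersedLeaf x
  have hx : x ∈ range f := by
    rw [hrange]
    exact F.leafRel.refl x
  obtain ⟨y, rfl⟩ := hx
  have hsub : Subsingleton (EuclideanSpace ℝ (Fin d)) := by
    refine ⟨fun a b => hinj y ?_⟩
    have hz : ∀ a, mfderiv (𝓡 d) I f y a = 0 := by
      intro a
      have h1 : mfderiv (𝓡 d) I f y a ∈ LinearMap.range (mfderiv (𝓡 d) I f y).toLinearMap :=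
        ⟨a, rfl⟩
      rwa [htan y, h, Submodule.mem_bot] at h1
    exact (hz a).trans (hz b).symm
  have : Subsingleton N :=
    ChartedSpace.subsingleton_of_connected_of_subsingleton (K := EuclideanSpace ℝ (Fin d))
  have h2 : F.leaf (f y) = range f := hrange.symm
  rw [h2]
  exact subsingleton_range f

/-- A nonzero positively oriented vector spans the leaf. -/
theorem SingularFoliation.Orientation.tangent_eq_span {F : SingularFoliation I M}
    (o : F.Orientation) (hflow : F.IsFlow) {x : M} (hx : F.tangent x ≠ ⊥) {v : TangentSpace I x}
    (hv : v ∈ o.pos x) : F.tangent x = Submodule.span ℝ {v} := by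
  obtain ⟨u, hu, hu0, hpos⟩ := o.pos_eq_ray x hx
  rw [hpos] at hv
  obtain ⟨c, hc, rfl⟩ := hv
  -- `finrank` is 0 on infinite-dimensional spaces, so the bound by one says nothing until
  -- finiteness is known; it comes from the finite-dimensional parametrisation of the leaf.
  have hfin : Module.Finite ℝ (F.tangent x) := by
    obtain ⟨d, N, _, _, -, -, -, _, f, -, -, hinj, hrange, htan⟩ := F.isImmersedLeaf x
    have hxr : x ∈ range f := by
      rw [hrange]
      exact F.leafRel.refl x
    obtain ⟨y, rfl⟩ := hxr
    rw [← htan y]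
    have : Module.Finite ℝ (TangentSpace (𝓡 d) y) :=
      inferInstanceAs (Module.Finite ℝ (EuclideanSpace ℝ (Fin d)))
    infer_instance
  have hcu : c • u ≠ 0 := smul_ne_zero hc.ne' hu0
  refine (Submodule.eq_of_le_of_finrank_le ?_ ?_).symm
  · rw [Submodule.span_singleton_le_iff_mem]
    exact Submodule.smul_mem _ _ hu
  · rw [finrank_span_singleton hcu]
    exact hflow.1 x

end Leaves

/-! ### The generating vector field of a weight flow -/

section WeightFlow

variable {k n : ℕ} {U : Type*} [TopologicalSpace U] [ChartedSpace (EuclideanSpace ℝ (Fin n)) U]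

/-- The velocity field of the flows `weightFlow (α s)` on the slices over `s`. -/
def weightField (α : U → EuclideanSpace ℝ (Fin k)) (x : EuclideanSpace ℂ (Fin k) × U) :
    TangentSpace (𝓘(ℝ, EuclideanSpace ℂ (Fin k)).prod (𝓡 n)) x :=
  ((weightGenerator k (α x.2) x.1, 0) : EuclideanSpace ℂ (Fin k) × EuclideanSpace ℝ (Fin n))

theorem weightField_ne_zero_iff {α : U → EuclideanSpace ℝ (Fin k)}
    {x : EuclideanSpace ℂ (Fin k) × U} :
    weightField (n := n) α x ≠ 0 ↔ weightGenerator k (α x.2) x.1 ≠ 0 := by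
  refine not_congr ⟨fun h => congrArg Prod.fst h, fun h => ?_⟩
  exact Prod.ext h rfl

theorem curveVelocity_sliceFlowLine (α : U → EuclideanSpace ℝ (Fin k))
    (z : EuclideanSpace ℂ (Fin k)) (s : U) :
    (curveVelocity (𝓘(ℝ, EuclideanSpace ℂ (Fin k)).prod (𝓡 n)) (sliceFlowLine (α s) z s) 0 :
      EuclideanSpace ℂ (Fin k) × EuclideanSpace ℝ (Fin n)) = weightField α (z, s) := by
  have h1 := (hasDerivAt_weightFlow (α s) z 0).hasFDerivAt.hasMFDerivAt
  have h2 : HasMFDerivAt 𝓘(ℝ, ℝ) (𝓡 n) (fun _ : ℝ => s) 0 _ := hasMFDerivAt_const s 0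
  have h3 := (h1.prodMk h2).mfderiv
  have h4 : (weightGenerator k (α s) (weightFlow (α s) 0 z)) = weightGenerator k (α s) z := by
    rw [weightFlow_zero]
  have h5 := congrArg
    (fun f : ℝ →L[ℝ] EuclideanSpace ℂ (Fin k) × EuclideanSpace ℝ (Fin n) => f 1) h3
  refine h5.trans (Prod.ext ?_ ?_)
  · refine Eq.trans ?_ h4
    exact one_smul ℝ _
  · rfl

variable [IsManifold (𝓡 n) ∞ U]
  {F : SingularFoliation (𝓘(ℝ, EuclideanSpace ℂ (Fin k)).prod (𝓡 n))
      (EuclideanSpace ℂ (Fin k) × U)}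
  {o : F.Orientation} {α : U → EuclideanSpace ℝ (Fin k)}

theorem RestrictsToWeightFlow.weightField_mem_pos (h : RestrictsToWeightFlow F o α)
    {x : EuclideanSpace ℂ (Fin k) × U} (hx : weightField (n := n) α x ≠ 0) :
    weightField α x ∈ o.pos x := by
  obtain ⟨z, s⟩ := x
  have h1 := (h z s).2
  have h2 := curveVelocity_sliceFlowLine (n := n) α z s
  -- The flow line at time 0 equals (z, s) only propositionally.
  have hpos : ∀ (x y : EuclideanSpace ℂ (Fin k) × U) (_ : x = y)
      (a b : EuclideanSpace ℂ (Fin k) × EuclideanSpace ℝ (Fin n)), a = b →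
      a ∈ o.pos x → b ∈ o.pos y := by
    rintro x _ rfl a _ rfl ha
    exact ha
  refine hpos (sliceFlowLine (α s) z s 0) (z, s) (by simp [sliceFlowLine]) _ _ h2
    (h1 fun h3 => hx (h2.symm.trans h3))

/-- A leaf with zero tangent space is a point, whereas an orbit with nonzero velocity moves. -/
theorem RestrictsToWeightFlow.tangent_ne_bot (h : RestrictsToWeightFlow F o α)
    {x : EuclideanSpace ℂ (Fin k) × U} (hx : weightField (n := n) α x ≠ 0) :
    F.tangent x ≠ ⊥ := by
  obtain ⟨z, s⟩ := x
  intro hbot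
  have h1 := F.subsingleton_leaf hbot
  rw [(h z s).1] at h1
  have h2 : (fun t => weightFlow (α s) t z) = fun _ => weightFlow (α s) 0 z := by
    funext t
    exact congrArg Prod.fst (h1 (mem_range_self t) (mem_range_self 0))
  have h3 := hasDerivAt_weightFlow (α s) z 0
  rw [h2, weightFlow_zero] at h3
  exact weightField_ne_zero_iff.1 hx (h3.unique (hasDerivAt_const _ _))

theorem RestrictsToWeightFlow.tangent_eq_span (h : RestrictsToWeightFlow F o α)
    (hflow : F.IsFlow) {x : EuclideanSpace ℂ (Fin k) × U} (hx : weightField (n := n) α x ≠ 0) :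
    F.tangent x = Submodule.span ℝ {weightField α x} :=
  o.tangent_eq_span hflow (h.tangent_ne_bot hx) (h.weightField_mem_pos hx)

theorem RestrictsToWeightFlow.weightField_mem_tangent (h : RestrictsToWeightFlow F o α)
    (hflow : F.IsFlow) (x : EuclideanSpace ℂ (Fin k) × U) : weightField α x ∈ F.tangent x := by
  by_cases hx : weightField (n := n) α x = 0
  · rw [hx]
    exact zero_mem _
  · rw [h.tangent_eq_span hflow hx]
    exact Submodule.mem_span_singleton_self _

/-- Imaginary parts of the coordinates. -/
def imCoordinates (k : ℕ) : EuclideanSpace ℂ (Fin k) →L[ℝ] EuclideanSpace ℝ (Fin k) :=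
  LinearMap.toContinuousLinearMap
    { toFun := fun z => WithLp.toLp 2 fun j => (z j).im
      map_add' := fun z w => by ext j; simp
      map_smul' := fun c z => by ext j; simp }

theorem imCoordinates_weightGenerator_const_one (β : EuclideanSpace ℝ (Fin k)) :
    imCoordinates k (weightGenerator k β (WithLp.toLp 2 fun _ => 1)) = β := by
  ext j
  simp [imCoordinates]

/-- The weights depend smoothly on the slice. -/
theorem RestrictsToWeightFlow.contMDiff (h : RestrictsToWeightFlow F o α)
    (hα : ∀ s, ‖α s‖ = 1) : ContMDiff (𝓡 n) 𝓘(ℝ, EuclideanSpace ℝ (Fin k)) ∞ α := by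
  intro s₀
  set e : EuclideanSpace ℂ (Fin k) := WithLp.toLp 2 fun _ => 1 with he
  have hne : ∀ s, weightField (n := n) α (e, s) ≠ 0 := by
    intro s
    rw [weightField_ne_zero_iff, ← norm_ne_zero_iff, norm_weightGenerator_const_one, hα]
    exact one_ne_zero
  obtain ⟨V, hV, -, hpos⟩ := o.exists_vectorField (e, s₀) (h.tangent_ne_bot (hne s₀))
  let W : U → EuclideanSpace ℂ (Fin k) := fun s =>
    (show EuclideanSpace ℂ (Fin k) × EuclideanSpace ℝ (Fin n) from V (e, s)).1
  have hW : ContMDiff (𝓡 n) 𝓘(ℝ, EuclideanSpace ℂ (Fin k)) ∞ W := by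
    have h1 : ContMDiff (𝓘(ℝ, EuclideanSpace ℂ (Fin k)).prod (𝓡 n)) 𝓘(ℝ, EuclideanSpace ℂ (Fin k)) ∞
        (Prod.fst : EuclideanSpace ℂ (Fin k) × U → EuclideanSpace ℂ (Fin k)) := contMDiff_fst
    have h2 := h1.contMDiff_tangentMap (m := ∞) le_rfl
    have h3 : ContMDiff (𝓡 n) (𝓘(ℝ, EuclideanSpace ℂ (Fin k)).prod (𝓡 n)) ∞ (fun s : U => (e, s)) :=
      contMDiff_const.prodMk contMDiff_id
    have h4 := (contMDiff_snd_tangentBundle_modelSpace (n := ∞) (EuclideanSpace ℂ (Fin k))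
      𝓘(ℝ, EuclideanSpace ℂ (Fin k))).comp (h2.comp (hV.comp h3))
    convert! h4 using 1
    funext s
    exact (congrArg (fun f : (EuclideanSpace ℂ (Fin k) × EuclideanSpace ℝ (Fin n)) →L[ℝ]
      EuclideanSpace ℂ (Fin k) => f (V (e, s)))
        (mfderiv_fst (I := 𝓘(ℝ, EuclideanSpace ℂ (Fin k))) (I' := 𝓡 n) (x := (e, s)))).symm
  -- Both fields lie on the same open ray. Positivity of c is what the orientation provides:
  -- normalising would otherwise determine α only up to sign.
  have hray : ∀ᶠ s in 𝓝 s₀, ∃ c : ℝ, 0 < c ∧ W s = c • weightGenerator k (α s) e := by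
    have hcont : ContinuousAt (fun s : U => (e, s)) s₀ := by fun_prop
    filter_upwards [hcont.eventually hpos] with s hs
    obtain ⟨u, -, -, hu⟩ := o.pos_eq_ray (e, s) (h.tangent_ne_bot (hne s))
    have h1 := h.weightField_mem_pos (hne s)
    rw [hu] at h1 hs
    obtain ⟨a, ha, hae⟩ := h1
    obtain ⟨b, hb, hbe⟩ := hs
    refine ⟨b / a, by positivity, ?_⟩
    have h2 : V (e, s) = (b / a) • weightField α (e, s) := by
      rw [hbe, hae, smul_smul]
      field_simp
    exact congrArg (fun x : EuclideanSpace ℂ (Fin k) × EuclideanSpace ℝ (Fin n) => x.1) h2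
  have heq : ∀ᶠ s in 𝓝 s₀, W s ≠ 0 ∧ α s = imCoordinates k (‖W s‖⁻¹ • W s) := by
    filter_upwards [hray] with s ⟨c, hc, hWs⟩
    have hn : ‖W s‖ = c := by
      rw [hWs, norm_smul, norm_weightGenerator_const_one, hα, mul_one, Real.norm_of_nonneg hc.le]
    refine ⟨by rw [← norm_ne_zero_iff, hn]; exact hc.ne', ?_⟩
    rw [hn, hWs, smul_smul, inv_mul_cancel₀ hc.ne', one_smul,
      imCoordinates_weightGenerator_const_one]
  have hN : ContDiffAt ℝ ∞ (fun z => imCoordinates k (‖z‖⁻¹ • z)) (W s₀) := by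
    have h0 := heq.self_of_nhds.1
    exact (imCoordinates k).contDiff.contDiffAt.comp (W s₀)
      (((contDiffAt_norm ℂ h0).inv (norm_ne_zero_iff.2 h0)).smul contDiffAt_id)
  have h5 := hN.contMDiffAt.comp s₀ (hW s₀)
  exact h5.congr_of_eventuallyEq (by filter_upwards [heq] with s hs using hs.2)

end WeightFlow

/-! ### Rigidity -/

section Main

variable {k n : ℕ} {U : Type*} [TopologicalSpace U] [ChartedSpace (EuclideanSpace ℝ (Fin n)) U]

theorem extChartAt_prod_target (s₀ : U) :
    (extChartAt (𝓘(ℝ, EuclideanSpace ℂ (Fin k)).prod (𝓡 n))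
      ((0, s₀) : EuclideanSpace ℂ (Fin k) × U)).target
      = univ ×ˢ (extChartAt (𝓡 n) s₀).target := by
  rw [extChartAt_prod, extChartAt_model_space_eq_id]
  rfl

theorem extChartAt_prod_symm (s₀ : U) :
    ⇑(extChartAt (𝓘(ℝ, EuclideanSpace ℂ (Fin k)).prod (𝓡 n))
      ((0, s₀) : EuclideanSpace ℂ (Fin k) × U)).symm
      = Prod.map id (extChartAt (𝓡 n) s₀).symm := by
  rw [extChartAt_prod, extChartAt_model_space_eq_id]
  rfl

variable [IsManifold (𝓡 n) ∞ U]
  {F : SingularFoliation (𝓘(ℝ, EuclideanSpace ℂ (Fin k)).prod (𝓡 n))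
      (EuclideanSpace ℂ (Fin k) × U)}
  {o : F.Orientation} {α : U → EuclideanSpace ℝ (Fin k)}

/-- The chart is the identity on the linear factor, so restricting its inverse to a slice computes
the derivative on vectors tangent to that slice. -/
theorem mfderiv_extChartAt_prod_symm_weightGenerator (α : U → EuclideanSpace ℝ (Fin k)) {s₀ : U}
    {p : EuclideanSpace ℂ (Fin k) × EuclideanSpace ℝ (Fin n)}
    (hp : p.2 ∈ (extChartAt (𝓡 n) s₀).target) :
    (mfderiv 𝓘(ℝ, EuclideanSpace ℂ (Fin k) × EuclideanSpace ℝ (Fin n))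
      (𝓘(ℝ, EuclideanSpace ℂ (Fin k)).prod (𝓡 n))
      (extChartAt (𝓘(ℝ, EuclideanSpace ℂ (Fin k)).prod (𝓡 n))
        ((0, s₀) : EuclideanSpace ℂ (Fin k) × U)).symm p
      ((weightGenerator k (α ((extChartAt (𝓡 n) s₀).symm p.2)) p.1, 0) :
        EuclideanSpace ℂ (Fin k) × EuclideanSpace ℝ (Fin n)) :
          EuclideanSpace ℂ (Fin k) × EuclideanSpace ℝ (Fin n))
      = weightField α ((extChartAt (𝓘(ℝ, EuclideanSpace ℂ (Fin k)).prod (𝓡 n))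
        ((0, s₀) : EuclideanSpace ℂ (Fin k) × U)).symm p) := by
  obtain ⟨z, w⟩ := p
  set x₀ : EuclideanSpace ℂ (Fin k) × U := (0, s₀) with hx₀
  set u := weightGenerator k (α ((extChartAt (𝓡 n) s₀).symm w)) z with hu
  have hsymm : ⇑(extChartAt (𝓘(ℝ, EuclideanSpace ℂ (Fin k)).prod (𝓡 n)) x₀).symm
      = Prod.map id (extChartAt (𝓡 n) s₀).symm := extChartAt_prod_symm s₀
  have hmem : (z, w) ∈ (extChartAt (𝓘(ℝ, EuclideanSpace ℂ (Fin k)).prod (𝓡 n)) x₀).target := by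
    rw [hx₀, extChartAt_prod_target]
    exact ⟨mem_univ _, hp⟩
  have h1 : HasFDerivAt (fun z : EuclideanSpace ℂ (Fin k) => (z, w))
      ((ContinuousLinearMap.id ℝ (EuclideanSpace ℂ (Fin k))).prod
        (0 : EuclideanSpace ℂ (Fin k) →L[ℝ] EuclideanSpace ℝ (Fin n))) z :=
    (hasFDerivAt_id z).prodMk (hasFDerivAt_const w z)
  have h2 := ((mdifferentiableAt_extChartAt_symm hmem).hasMFDerivAt.comp z h1.hasMFDerivAt).mfderiv
  have h3 := ((hasMFDerivAt_id (I := 𝓘(ℝ, EuclideanSpace ℂ (Fin k))) z).prodMk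
    (hasMFDerivAt_const (I := 𝓘(ℝ, EuclideanSpace ℂ (Fin k))) (I' := 𝓡 n)
      ((extChartAt (𝓡 n) s₀).symm w) z)).mfderiv
  have h4 : (extChartAt (𝓘(ℝ, EuclideanSpace ℂ (Fin k)).prod (𝓡 n)) x₀).symm ∘ (fun z => (z, w))
      = fun z => (id z, (extChartAt (𝓡 n) s₀).symm w) := by
    rw [hsymm]
    rfl
  rw [h4] at h2
  have h5 := congrArg (fun f : EuclideanSpace ℂ (Fin k) →L[ℝ]
    EuclideanSpace ℂ (Fin k) × EuclideanSpace ℝ (Fin n) => f u) (h2.symm.trans h3)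
  refine h5.trans ?_
  rw [hsymm]
  rfl

/-- The weights of a singular Riemannian flow have vanishing derivative in charts. -/
theorem RestrictsToWeightFlow.fderiv_eq_zero (h : RestrictsToWeightFlow F o α)
    (hflow : F.IsFlow)
    {g : SmoothRiemannianMetric (𝓘(ℝ, EuclideanSpace ℂ (Fin k)).prod (𝓡 n))
      (EuclideanSpace ℂ (Fin k) × U)} (hriem : F.IsRiemannian g)
    (hα : ∀ s, ‖α s‖ = 1) {s₀ : U} {w : EuclideanSpace ℝ (Fin n)}
    (hw : w ∈ (extChartAt (𝓡 n) s₀).target) :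
    HasFDerivAt (fun w => α ((extChartAt (𝓡 n) s₀).symm w))
      (0 : EuclideanSpace ℝ (Fin n) →L[ℝ] EuclideanSpace ℝ (Fin k)) w := by
  set a : EuclideanSpace ℝ (Fin n) → EuclideanSpace ℝ (Fin k) :=
    fun w => α ((extChartAt (𝓡 n) s₀).symm w) with ha
  have had : DifferentiableAt ℝ a w := by
    have h1 := ((h.contMDiff hα).mdifferentiable (by simp) ((extChartAt (𝓡 n) s₀).symm w)).comp w
      (mdifferentiableAt_extChartAt_symm (I := 𝓡 n) hw)
    exact h1.differentiableAt
  set x₀ : EuclideanSpace ℂ (Fin k) × U := (0, s₀) with hx₀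
  have htarget : ∀ z : EuclideanSpace ℂ (Fin k), (z, w) ∈ (extChartAt
      (𝓘(ℝ, EuclideanSpace ℂ (Fin k)).prod (𝓡 n)) x₀).target := by
    intro z
    rw [hx₀, extChartAt_prod_target]
    exact ⟨mem_univ _, hw⟩
  have hinner : ∀ v, inner ℝ (a w) (fderiv ℝ a w v) = 0 := by
    intro v
    have h1 := had.hasFDerivAt.norm_sq
    have h2 : (fun w => ‖a w‖ ^ 2) = fun _ => (1 : ℝ) := by
      funext w
      simp [ha, hα]
    rw [h2] at h1
    have h3 := congrArg (fun f => f v) (h1.unique (hasFDerivAt_const _ _))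
    simpa using h3
  suffices h0 : fderiv ℝ a w = 0 by
    have h1 := had.hasFDerivAt
    rwa [h0] at h1
  refine weights_deriv_eq_zero (α := a w) (G := g.coordinateMetric x₀) (w₀ := w)
    (((g.contDiffOn_coordinateMetric x₀).contDiffAt
      ((isOpen_extChartAt_target x₀).mem_nhds (htarget 0))).of_le (by norm_cast))
    (Filter.Eventually.of_forall fun p => g.coordinateMetric_symm x₀ p)
    (fun v hv => g.coordinateMetric_pos x₀ (htarget 0) hv)
    (norm_ne_zero_iff.1 (by rw [ha, hα]; exact one_ne_zero)) hinner fun z hz v hv => ?_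
  let Y : EuclideanSpace ℂ (Fin k) × EuclideanSpace ℝ (Fin n) →
      EuclideanSpace ℂ (Fin k) × EuclideanSpace ℝ (Fin n) := fun p =>
    (weightGenerator k (a p.2) p.1, 0)
  -- The product rule for i a(w) z: the variation of z gives the linear part, the variation of the
  -- weights the transverse term.
  have hY : HasFDerivAt Y (((weightGenerator k (a w)).comp (ContinuousLinearMap.fst ℝ _ _)
      + ((weightGenerator k).flip z).comp
        ((fderiv ℝ a w).comp (ContinuousLinearMap.snd ℝ _ _))).prod 0) (z, w) := by
    have h1 : HasFDerivAt (fun p : EuclideanSpace ℂ (Fin k) × EuclideanSpace ℝ (Fin n) => a p.2)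
        ((fderiv ℝ a w).comp (ContinuousLinearMap.snd ℝ _ _)) (z, w) :=
      HasFDerivAt.comp (z, w) (g := a) (f := Prod.snd) had.hasFDerivAt hasFDerivAt_snd
    have h2 := ((weightGenerator k).hasFDerivAt.comp (z, w) h1).clm_apply
      (hasFDerivAt_fst (𝕜 := ℝ) (p := (z, w)))
    exact h2.prodMk (hasFDerivAt_const 0 _)
  exact hriem.lie_apply_eq_zero (h.weightField_mem_tangent hflow)
    (fun x hx => (h.tangent_eq_span hflow hx).le) (x₀ := x₀) (Y := Y)
    (fun p hp => mfderiv_extChartAt_prod_symm_weightGenerator α (by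
      rw [hx₀, extChartAt_prod_target] at hp
      exact hp.2)) (htarget z) hY (fun h0 => hz (congrArg Prod.fst h0)) hv

theorem RestrictsToWeightFlow.isLocallyConstant (h : RestrictsToWeightFlow F o α)
    (hflow : F.IsFlow)
    {g : SmoothRiemannianMetric (𝓘(ℝ, EuclideanSpace ℂ (Fin k)).prod (𝓡 n))
      (EuclideanSpace ℂ (Fin k) × U)} (hriem : F.IsRiemannian g)
    (hα : ∀ s, ‖α s‖ = 1) : IsLocallyConstant α := by
  rw [IsLocallyConstant.iff_eventually_eq]
  intro s₀
  set χ := extChartAt (𝓡 n) s₀ with hχ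
  obtain ⟨ε, hε, hball⟩ := Metric.isOpen_iff.1 (isOpen_extChartAt_target (I := 𝓡 n) s₀) (χ s₀)
    (mem_extChartAt_target s₀)
  have hder : ∀ w ∈ Metric.ball (χ s₀) ε, HasFDerivAt (fun w => α (χ.symm w)) 0 w :=
    fun w hw => h.fderiv_eq_zero hflow hriem hα (hball hw)
  have hcont : ∀ᶠ s in 𝓝 s₀, s ∈ χ.source ∧ χ s ∈ Metric.ball (χ s₀) ε :=
    Filter.Eventually.and ((isOpen_extChartAt_source s₀).mem_nhds (mem_extChartAt_source s₀))
      ((continuousAt_extChartAt s₀).eventually (Metric.ball_mem_nhds _ hε))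
  filter_upwards [hcont] with s hs
  have h1 := Metric.isOpen_ball.is_const_of_fderiv_eq_zero (𝕜 := ℝ)
    (convex_ball (χ s₀) ε).isPreconnected
    (fun w hw => (hder w hw).differentiableAt.differentiableWithinAt)
    (fun w hw => (hder w hw).fderiv) hs.2 (Metric.mem_ball_self hε)
  simpa only [χ.left_inv hs.1, χ.left_inv (mem_extChartAt_source s₀)] using h1

end Main

end

theorem mainTheorem7 {n k : ℕ} {S : Type*} [TopologicalSpace S] [T2Space S]
    [SecondCountableTopology S] [ChartedSpace (EuclideanSpace ℝ (Fin n)) S]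
    [IsManifold (𝓡 n) ∞ S]
    (U : TopologicalSpace.Opens S) (hU : IsConnected (U : Set S))
    (F : SingularFoliation (𝓘(ℝ, EuclideanSpace ℂ (Fin k)).prod (𝓡 n))
      (EuclideanSpace ℂ (Fin k) × U))
    (hflow : F.IsFlow) (o : F.Orientation)
    (g : SmoothRiemannianMetric (𝓘(ℝ, EuclideanSpace ℂ (Fin k)).prod (𝓡 n))
      (EuclideanSpace ℂ (Fin k) × U))
    (hriem : F.IsRiemannian g)
    (α : U → Metric.sphere (0 : EuclideanSpace ℝ (Fin k)) 1)
    (hα : RestrictsToWeightFlow F o (fun s => (α s : EuclideanSpace ℝ (Fin k)))) :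
    ∃ a : Metric.sphere (0 : EuclideanSpace ℝ (Fin k)) 1, ∀ s : U, α s = a := by
  have : ConnectedSpace U := isConnected_iff_connectedSpace.1 hU
  have hloc := hα.isLocallyConstant hflow hriem fun s => by simp
  obtain ⟨s₀⟩ : Nonempty U := inferInstance
  exact ⟨α s₀, fun s => Subtype.ext (hloc.apply_eq_of_preconnectedSpace s s₀)⟩
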